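/- Let $0<\delta<W$ and, for $n\in\mathbb Z$, let $t_n^{\pm}:=W\pm(-1)^n\delta$. For a bounded real sequence $a=(a_n)_{n\in\mathbb Z}$ let the corresponding capital letter $A$ denote the bounded self-adjoint operator on $\ell^2(\mathbb Z,\mathbb C)$ given by $(A\psi)_n=a_{n-1}\psi_{n-1}+a_n\psi_{n+1}$, that is, $A_{n,n+1}=A_{n+1,n}=a_n$ and all other matrix entries vanish. For a bounded self-adjoint operator $A$ write $A_-:=-A\,\mathbf 1(A<0)$. A real sequence $t$ is called homoclinic if $|t_n-t_n^+|\to0$ as $n\to-\infty$ and as $n\to+\infty$, and heteroclinic if $|t_n-t_n^-|\to0$ as $n\to-\infty$ and $|t_n-t_n^+|\to0$ as $n\to+\infty$ (such sequences are bounded). Let $t$ be homoclinic or heteroclinic with $t_n\ge\tau$ for all $n\in\mathbb Z$, for some $\tau>0$. Then $g:=\operatorname{dist}(0,\sigma(T)\setminus\{0\})>0$, and there are a number $\Sigma<-g/2$, a constant $C\ge0$ and a constant $\eta>0$ (all depending on $t$) such that, with $\mathscr C$ the positively oriented rectangular contour $$(\Sigma+i)\to(\Sigma-i)\to(-g/2-i)\to(-g/2+i)\to(\Sigma+i),$$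 the following holds for every bounded real sequence $h$ with $\|h\|_{\ell^\infty}\le\eta$: 1. for all $z\in\mathscr C$ the operator $z-(T+H)$ is invertible, with $\|(z-(T+H))^{-1}\|_{\rm op}\le C$; 2. $\displaystyle -(T+H)_-=\frac1{2\pi i}\oint_{\mathscr C} z\,(z-(T+H))^{-1}\,dz$; 3. if $t$ is homoclinic, then $0\notin\sigma(T+H)$; 4. if $t$ is heteroclinic, then $0$ is an eigenvalue of $T+H$ of multiplicity $1$ and an isolated point of $\sigma(T+H)$. -/

import Mathlib

open scoped ENNReal

noncomputable section

namespace SSH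

/-- The Hilbert space `ℓ²(ℤ, ℂ)`. -/
abbrev Hil : Type := lp (fun _ : ℤ => ℂ) 2

/-- Bounded real sequences `ℓ^∞(ℤ, ℝ)`, with the supremum norm. -/
abbrev Seq : Type := lp (fun _ : ℤ => ℝ) ∞

/-- The dimerized configuration `t⁺_n = W + (-1)^n δ`. -/
def dimerPlus (W δ : ℝ) (n : ℤ) : ℝ := W + (-1 : ℝ) ^ n * δ

/-- The dimerized configuration `t⁻_n = W - (-1)^n δ`. -/
def dimerMinus (W δ : ℝ) (n : ℤ) : ℝ := W - (-1 : ℝ) ^ n * δ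

/-- `t` converges to `t⁺` both at `-∞` and at `+∞`. -/
def IsHomoclinic (W δ : ℝ) (t : ℤ → ℝ) : Prop :=
  Filter.Tendsto (fun n => |t n - dimerPlus W δ n|) Filter.atBot (nhds 0) ∧
    Filter.Tendsto (fun n => |t n - dimerPlus W δ n|) Filter.atTop (nhds 0)

/-- `t` converges to `t⁻` at `-∞` and to `t⁺` at `+∞`. -/
def IsHeteroclinic (W δ : ℝ) (t : ℤ → ℝ) : Prop :=
  Filter.Tendsto (fun n => |t n - dimerMinus W δ n|) Filter.atBot (nhds 0) ∧
    Filter.Tendsto (fun n => |t n - dimerPlus W δ n|) Filter.atTop (nhds 0)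

theorem memℓp_mul_comp (a : Seq) (e f : ℤ ≃ ℤ) (ψ : Hil) :
    Memℓp (fun n => ((a (e n) : ℝ) : ℂ) * ψ (f n)) 2 := by
  have h2 : (0 : ℝ) < (2 : ℝ≥0∞).toReal := by norm_num
  rw [memℓp_gen_iff h2]
  have hs := (f.summable_iff.mpr ((memℓp_gen_iff h2).mp (lp.memℓp ψ))).mul_left (‖a‖ ^ 2)
  refine Summable.of_nonneg_of_le (fun n => by positivity) (fun n => ?_) hs
  have ha : ‖a (e n)‖ ≤ ‖a‖ := lp.norm_apply_le_norm (by simp) a (e n)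
  simp only [norm_mul, Complex.norm_real, ENNReal.toReal_ofNat, Real.rpow_ofNat, mul_pow,
    Function.comp_apply]
  gcongr

theorem norm_mul_comp_le (a : Seq) (e f : ℤ ≃ ℤ) (ψ : Hil) :
    ‖(⟨_, memℓp_mul_comp a e f ψ⟩ : Hil)‖ ≤ ‖a‖ * ‖ψ‖ := by
  have h2 : (0 : ℝ) < (2 : ℝ≥0∞).toReal := by norm_num
  refine lp.norm_le_of_tsum_le h2 (by positivity) ?_
  have hs := (f.summable_iff.mpr ((memℓp_gen_iff h2).mp (lp.memℓp ψ))).mul_left (‖a‖ ^ 2)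
  have hle := Summable.tsum_le_tsum (fun n => ?_)
    ((memℓp_gen_iff h2).mp (memℓp_mul_comp a e f ψ)) hs
  · refine hle.trans (le_of_eq ?_)
    rw [tsum_mul_left, Real.mul_rpow (norm_nonneg _) (norm_nonneg _), lp.norm_rpow_eq_tsum h2]
    congr 1
    · simp
    · exact f.tsum_eq (fun n => ‖ψ n‖ ^ (2 : ℝ≥0∞).toReal)
  · have ha : ‖a (e n)‖ ≤ ‖a‖ := lp.norm_apply_le_norm (by simp) a (e n)
    simp only [norm_mul, Complex.norm_real, ENNReal.toReal_ofNat, Real.rpow_ofNat, mul_pow,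
      Function.comp_apply]
    gcongr

/-- The operator on `ℓ²(ℤ, ℂ)` with matrix entries `A_{n,n+1} = A_{n+1,n} = a_n`, all others `0`:
`(A ψ)_n = a_{n-1} ψ_{n-1} + a_n ψ_{n+1}`. -/
def hop (a : Seq) : Hil →L[ℂ] Hil :=
  LinearMap.mkContinuous
    { toFun := fun ψ =>
        ⟨fun n => ((a (n - 1) : ℝ) : ℂ) * ψ (n - 1) + ((a n : ℝ) : ℂ) * ψ (n + 1),
          (memℓp_mul_comp a (Equiv.subRight 1) (Equiv.subRight 1) ψ).add
            (memℓp_mul_comp a (Equiv.refl ℤ) (Equiv.addRight 1) ψ)⟩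
      map_add' := fun φ ψ => by
        ext n
        simp only [lp.coeFn_add, Pi.add_apply]
        ring
      map_smul' := fun c ψ => by
        ext n
        simp only [lp.coeFn_smul, Pi.smul_apply, smul_eq_mul, RingHom.id_apply]
        ring }
    (2 * ‖a‖)
    (fun ψ => by
      have h1 := norm_mul_comp_le a (Equiv.subRight 1) (Equiv.subRight 1) ψ
      have h2 := norm_mul_comp_le a (Equiv.refl ℤ) (Equiv.addRight 1) ψ
      refine (norm_add_le (⟨_, memℓp_mul_comp a (Equiv.subRight 1) (Equiv.subRight 1) ψ⟩ : Hil)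
        ⟨_, memℓp_mul_comp a (Equiv.refl ℤ) (Equiv.addRight 1) ψ⟩).trans ?_
      linarith)

theorem hop_apply (a : Seq) (ψ : Hil) (n : ℤ) :
    hop a ψ n = ((a (n - 1) : ℝ) : ℂ) * ψ (n - 1) + ((a n : ℝ) : ℂ) * ψ (n + 1) := rfl

/-- `hop a` is self-adjoint, so that its negative part, taken by the continuous functional
calculus, is the usual one. -/
theorem isSelfAdjoint_hop (a : Seq) : IsSelfAdjoint (hop a) := by
  rw [ContinuousLinearMap.isSelfAdjoint_iff_isSymmetric]
  intro φ ψ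
  have s1 := lp.summable_inner (𝕜 := ℂ) φ
    (⟨_, memℓp_mul_comp a (Equiv.subRight 1) (Equiv.subRight 1) ψ⟩ : Hil)
  have s2 := lp.summable_inner (𝕜 := ℂ) φ
    (⟨_, memℓp_mul_comp a (Equiv.refl ℤ) (Equiv.addRight 1) ψ⟩ : Hil)
  have s3 := lp.summable_inner (𝕜 := ℂ)
    (⟨_, memℓp_mul_comp a (Equiv.subRight 1) (Equiv.subRight 1) φ⟩ : Hil) ψ
  have s4 := lp.summable_inner (𝕜 := ℂ)
    (⟨_, memℓp_mul_comp a (Equiv.refl ℤ) (Equiv.addRight 1) φ⟩ : Hil) ψ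
  have e1 : inner ℂ (hop a φ) ψ = _ := (lp.inner_eq_tsum (hop a φ) ψ).trans
    ((tsum_congr fun n => inner_add_left _ _ _).trans (s3.tsum_add s4))
  have e2 : inner ℂ φ (hop a ψ) = _ := (lp.inner_eq_tsum φ (hop a ψ)).trans
    ((tsum_congr fun n => inner_add_right _ _ _).trans (s1.tsum_add s2))
  refine e1.trans (Eq.trans ?_ e2.symm)
  rw [add_comm]
  congr 1
  · rw [← (Equiv.subRight (1 : ℤ)).tsum_eq]
    refine tsum_congr fun n => ?_
    simp [mul_assoc, mul_left_comm]
  · rw [← (Equiv.addRight (1 : ℤ)).tsum_eq]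
    refine tsum_congr fun n => ?_
    simp [mul_assoc, mul_left_comm]

section General

variable {E : Type*} [NormedAddCommGroup E] [InnerProductSpace ℂ E] [CompleteSpace E]

/-- The negative part `A_- = -A 𝟙(A < 0)` of a self-adjoint bounded operator, i.e. the function
`x ↦ max (-x) 0` of `A` in the continuous functional calculus. -/
def negativePart (A : E →L[ℂ] E) : E →L[ℂ] E := A⁻

/-- The distance `g = dist(0, σ(A) \ {0})`. -/
def gap (A : E →L[ℂ] E) : ℝ := Metric.infDist 0 (spectrum ℂ A \ {0})

/-- The complex line integral `∫_γ f(z) dz` of an operator-valued function: the curve integral of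
the one-form `v ↦ v • f z`. -/
def lineIntegral {p q : ℂ} (γ : Path p q) (f : ℂ → (E →L[ℂ] E)) : E →L[ℂ] E :=
  curveIntegral (fun z : ℂ => ContinuousLinearMap.toSpanSingleton ℂ (f z)) γ

/-- `μ` is an eigenvalue of `A` of multiplicity one, and an isolated point of the spectrum. -/
def IsSimpleIsolatedEigenvalue (A : E →L[ℂ] E) (μ : ℂ) : Prop :=
  Module.End.HasEigenvalue (A : E →ₗ[ℂ] E) μ ∧
    Module.finrank ℂ (Module.End.eigenspace (A : E →ₗ[ℂ] E) μ) = 1 ∧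
    ∃ ε > 0, spectrum ℂ A ∩ Metric.ball μ ε = {μ}

end General

/-- The closed rectangular path
`(l + i) → (l - i) → (r - i) → (r + i) → (l + i)`,
positively oriented (counterclockwise) if `l < r`. -/
def contour (l r : ℝ) : Path ((l : ℂ) + Complex.I) ((l : ℂ) + Complex.I) :=
  (Path.segment ((l : ℂ) + Complex.I) ((l : ℂ) - Complex.I)).trans
    ((Path.segment ((l : ℂ) - Complex.I) ((r : ℂ) - Complex.I)).trans
      ((Path.segment ((r : ℂ) - Complex.I) ((r : ℂ) + Complex.I)).trans
        (Path.segment ((r : ℂ) + Complex.I) ((l : ℂ) + Complex.I))))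

end SSH

end

open scoped ENNReal

noncomputable section

namespace SSH

open Set MeasureTheory Filter Topology

/-! ### Logarithmic integrals along segments -/

/-! Put `a = t + h`. Hopping changes the parity of a site, so `hop a` is off-diagonal for the
even/odd splitting of `ℤ`, and each sublattice carries a two-step recurrence. If every other bond is
the stronger one, solving a row for one entry bounds it by the source plus a ratio below `1` times
the next entry. Weights absorb the finitely many bad ratios (`tsum_sq_le_of_le_add_shift`), giving
`‖ψ‖ ≤ const * ‖hop a ψ‖` uniformly in small `h`.

In the homoclinic case this works on both sublattices, so `hop a` is invertible. In the heteroclinic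
case it works on the even sublattice, running outwards from a cut towards each end. On the odd
sublattice the zero-energy recurrence has a one-dimensional solution space, and its solutions decay
at both ends; they span the kernel (`finrank_ker_hop`). Self-adjointness carries the even bound over
to the whole orthogonal complement of the kernel (`lower_bound_orthogonal_ker_of_chiral`). In both
cases `0` is the only possible spectral point in a ball around `0` whose radius does not depend on
`h`.

A Neumann series keeps the spectrum of `T + H` near that of `T`. With the uniform bound, only `0`
and points of modulus above `3g/4` remain, so the contour through `-g/2` stays in the resolvent set
(`eq_zero_or_of_mem_spectrum_add`).

For the integral formula, the functional calculus reduces the contour integral to that of `z / (z -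
x)` for real `x`, computed with logarithms: `2πi x` inside the rectangle and `0` to its right. On
the spectrum this is `2πi` times minus the negative part. -/

theorem hasDerivAt_log_mul_lineMap_sub {p q x c : ℂ} {s : ℝ} (hc : c ≠ 0)
    (h : c * (AffineMap.lineMap p q s - x) ∈ Complex.slitPlane) :
    HasDerivAt (fun s : ℝ => Complex.log (c * (AffineMap.lineMap p q s - x)))
      ((q - p) * (AffineMap.lineMap p q s - x)⁻¹) s := by
  have h1 : HasDerivAt (fun s : ℝ => c * (AffineMap.lineMap p q s - x)) (c * (q - p)) s :=
    (AffineMap.hasDerivAt_lineMap.sub_const x).const_mul c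
  have h2 := h1.clog_real h
  convert h2 using 1
  have h3 := Complex.slitPlane_ne_zero h
  have h4 : (AffineMap.lineMap p q s - x : ℂ) ≠ 0 := right_ne_zero_of_mul h3
  field_simp

theorem continuousOn_div_lineMap_sub {p q x : ℂ} (hx : x ∉ segment ℝ p q) :
    ContinuousOn (fun s : ℝ => (q - p) * (AffineMap.lineMap p q s - x : ℂ)⁻¹) (Icc 0 1) := by
  refine continuousOn_const.mul (ContinuousOn.inv₀ ?_ fun s hs h0 => hx ?_)
  · exact (AffineMap.lineMap_continuous.continuousOn).sub continuousOn_const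
  · rw [← sub_eq_zero.mp h0]
    exact lineMap_mem_segment ℝ p q hs

/-- The factor `c` does not change the logarithmic derivative; it only rotates the branch cut away
from the segment. -/
theorem integral_inv_lineMap_sub_eq_log {p q x c : ℂ}
    (h : ∀ z ∈ segment ℝ p q, c * (z - x) ∈ Complex.slitPlane) :
    ∫ s in (0 : ℝ)..1, (q - p) * (AffineMap.lineMap p q s - x : ℂ)⁻¹ =
      Complex.log (c * (q - x)) - Complex.log (c * (p - x)) := by
  have hc : c ≠ 0 := left_ne_zero_of_mul
    (Complex.slitPlane_ne_zero (h p (left_mem_segment ℝ p q)))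
  have hx : x ∉ segment ℝ p q := fun hx => Complex.slitPlane_ne_zero (h x hx) (by simp)
  have hd : ∀ s ∈ uIcc (0 : ℝ) 1, HasDerivAt (fun s : ℝ =>
      Complex.log (c * (AffineMap.lineMap p q s - x)))
      ((q - p) * (AffineMap.lineMap p q s - x)⁻¹) s := fun s hs => by
    rw [uIcc_of_le zero_le_one] at hs
    exact hasDerivAt_log_mul_lineMap_sub hc (h _ (lineMap_mem_segment ℝ p q hs))
  rw [intervalIntegral.integral_eq_sub_of_hasDerivAt hd
    ((continuousOn_div_lineMap_sub hx).intervalIntegrable_of_Icc zero_le_one)]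
  simp

/-- If the quotient were a real number `-m ≤ 0`, then `x` would be a convex combination of `p` and
`z`, hence on the segment. So `c = (p - x)⁻¹` is always an admissible rotation. -/
theorem div_sub_mem_slitPlane {p q x z : ℂ} (hx : x ∉ segment ℝ p q) (hz : z ∈ segment ℝ p q) :
    (p - x)⁻¹ * (z - x) ∈ Complex.slitPlane := by
  have hp : p - x ≠ 0 := fun h => hx (sub_eq_zero.mp h ▸ left_mem_segment ℝ p q)
  by_contra hs
  rw [Complex.mem_slitPlane_iff] at hs
  push Not at hs
  obtain ⟨hre, him⟩ := hs
  set m : ℝ := -((p - x)⁻¹ * (z - x)).re with hm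
  have hm0 : 0 ≤ m := by linarith
  have hzx : z - x = -(m : ℂ) * (p - x) := by
    have : (p - x)⁻¹ * (z - x) = -(m : ℂ) := by
      apply Complex.ext <;> simp [hm, him]
    rw [← this]
    field_simp
  refine hx ((convex_segment p q).segment_subset (left_mem_segment ℝ p q) hz
    ⟨m / (1 + m), 1 / (1 + m), by positivity, by positivity, by field_simp; ring, ?_⟩)
  have h1 : (1 + m : ℂ) ≠ 0 := by
    have : (1 + m : ℝ) ≠ 0 := by positivity
    exact_mod_cast this
  simp only [Complex.real_smul]
  push_cast
  field_simp
  linear_combination hzx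

/-- The integral of `z / (z - x)` along a segment that avoids `x`. -/
theorem integral_mul_inv_lineMap_sub {p q x : ℂ} (hx : x ∉ segment ℝ p q) :
    ∫ s in (0 : ℝ)..1, (q - p) * (AffineMap.lineMap p q s * (AffineMap.lineMap p q s - x)⁻¹ : ℂ) =
      (q - p) + x * Complex.log ((p - x)⁻¹ * (q - x)) := by
  have hp : p - x ≠ 0 := fun h => hx (sub_eq_zero.mp h ▸ left_mem_segment ℝ p q)
  have hlog := integral_inv_lineMap_sub_eq_log (p := p) (q := q) (x := x) (c := (p - x)⁻¹)
    fun z hz => div_sub_mem_slitPlane hx hz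
  rw [inv_mul_cancel₀ hp, Complex.log_one, sub_zero] at hlog
  -- Split `z / (z - x) = 1 + x / (z - x)`.
  rw [← hlog, ← intervalIntegral.integral_const_mul]
  have hc : ∫ s in (0 : ℝ)..1, (q - p) = q - p := by simp
  nth_rewrite 2 [← hc]
  rw [← intervalIntegral.integral_add (by simp)
    (((continuousOn_div_lineMap_sub hx).intervalIntegrable_of_Icc zero_le_one).const_mul x)]
  refine intervalIntegral.integral_congr fun s hs => ?_
  rw [uIcc_of_le zero_le_one] at hs
  have h0 : (AffineMap.lineMap p q s - x : ℂ) ≠ 0 := fun h0 => hx (by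
    rw [← sub_eq_zero.mp h0]; exact lineMap_mem_segment ℝ p q hs)
  field_simp
  ring

theorem continuousOn_log_div_sub {p q : ℂ} {S : Set ℂ} (hS : ∀ x ∈ S, x ∉ segment ℝ p q) :
    ContinuousOn (fun x => (q - p) + x * Complex.log ((p - x)⁻¹ * (q - x))) S := by
  refine continuousOn_const.add (continuousOn_id.mul (ContinuousOn.clog ?_ fun x hx =>
    div_sub_mem_slitPlane (hS x hx) (right_mem_segment ℝ p q)))
  refine ContinuousOn.mul (ContinuousOn.inv₀ (by fun_prop) fun x hx h => ?_) (by fun_prop)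
  exact hS x hx (sub_eq_zero.mp h ▸ left_mem_segment ℝ p q)

/-! ### Resolvents and the functional calculus -/

section General

variable {E : Type*} [NormedAddCommGroup E] [InnerProductSpace ℂ E] [CompleteSpace E]

theorem resolvent_eq_cfc {B : E →L[ℂ] E} (hB : IsSelfAdjoint B) {z : ℂ} (hz : z ∉ spectrum ℂ B) :
    resolvent B z = cfc (fun x : ℂ => (z - x)⁻¹) B := by
  have hn : IsStarNormal B := hB.isStarNormal
  have hne : ∀ x ∈ spectrum ℂ B, z - x ≠ 0 := fun x hx h => hz (sub_eq_zero.mp h ▸ hx)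
  rw [cfc_inv (fun x : ℂ => z - x) B hne (by fun_prop), cfc_sub (fun _ => z) (fun x => x) B,
    cfc_const z B, cfc_id' ℂ B]
  rfl

theorem norm_resolvent_le {B : E →L[ℂ] E} (hB : IsSelfAdjoint B) {z : ℂ} {d : ℝ} (hd : 0 < d)
    (h : ∀ x ∈ spectrum ℂ B, d ≤ ‖z - x‖) : ‖resolvent B z‖ ≤ d⁻¹ := by
  have hz : z ∉ spectrum ℂ B := fun hz => by simpa using hd.trans_le (h z hz)
  rw [resolvent_eq_cfc hB hz]
  refine norm_cfc_le (by positivity) fun x hx => ?_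
  rw [norm_inv]
  exact inv_anti₀ hd (h x hx)

/-- Neumann series: `z - (B + H) = (z - B)(1 - R H)` with `R` the resolvent of `B` at `z` and `‖R H‖
< 1`. -/
theorem isUnit_algebraMap_sub_add {B H : E →L[ℂ] E} (hB : IsSelfAdjoint B) {z : ℂ} {d : ℝ}
    (hH : ‖H‖ < d) (h : ∀ x ∈ spectrum ℂ B, d ≤ ‖z - x‖) :
    IsUnit (algebraMap ℂ (E →L[ℂ] E) z - (B + H)) := by
  have hd : 0 < d := (norm_nonneg H).trans_lt hH
  have hz : z ∉ spectrum ℂ B := fun hz => by simpa using hd.trans_le (h z hz)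
  have hu : IsUnit (algebraMap ℂ (E →L[ℂ] E) z - B) := spectrum.notMem_iff.mp hz
  have hR : ‖resolvent B z * H‖ < 1 := by
    refine (norm_mul_le _ _).trans_lt ?_
    calc ‖resolvent B z‖ * ‖H‖ ≤ d⁻¹ * ‖H‖ := by gcongr; exact norm_resolvent_le hB hd h
      _ < d⁻¹ * d := by gcongr
      _ = 1 := inv_mul_cancel₀ hd.ne'
  have h1 := hu.mul (isUnit_one_sub_of_norm_lt_one hR)
  convert h1 using 1
  rw [mul_sub, mul_one, ← mul_assoc, resolvent, Ring.mul_inverse_cancel _ hu, one_mul,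
    sub_add_eq_sub_sub]

theorem negativePart_eq_cfc {B : E →L[ℂ] E} (hB : IsSelfAdjoint B) :
    negativePart B = cfc (fun x : ℂ => ((x.re⁻ : ℝ) : ℂ)) B := by
  rw [negativePart, CFC.negPart_def, cfcₙ_eq_cfc (hf0 := by simp), cfc_real_eq_complex _ hB]

/-- The integrand of a segment integral of `z • (z - x)⁻¹`. -/
def segmentKernel (p q : ℂ) (s : ℝ) (x : ℂ) : ℂ :=
  (q - p) * (AffineMap.lineMap p q s * (AffineMap.lineMap p q s - x)⁻¹)

theorem continuousOn_segmentKernel {p q : ℂ} {S : Set ℂ} (hS : ∀ x ∈ S, x ∉ segment ℝ p q) :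
    ContinuousOn (Function.uncurry (segmentKernel p q)) (Icc 0 1 ×ˢ S) := by
  have hl : Continuous fun y : ℝ × ℂ => (AffineMap.lineMap p q y.1 : ℂ) :=
    AffineMap.lineMap_continuous.comp continuous_fst
  refine continuousOn_const.mul (hl.continuousOn.mul (ContinuousOn.inv₀
    (hl.sub continuous_snd).continuousOn fun y hy h0 => hS y.2 hy.2 ?_))
  rw [← sub_eq_zero.mp h0]
  exact lineMap_mem_segment ℝ p q hy.1

theorem exists_bound_segmentKernel {p q : ℂ} {S : Set ℂ} (hSc : IsCompact S)
    (hS : ∀ x ∈ S, x ∉ segment ℝ p q) :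
    ∃ M : ℝ, ∀ s ∈ Icc (0 : ℝ) 1, ∀ x ∈ S, ‖segmentKernel p q s x‖ ≤ M := by
  obtain ⟨M, hM⟩ := (isCompact_Icc.prod hSc).exists_bound_of_continuousOn
    (continuousOn_segmentKernel hS)
  exact ⟨M, fun s hs x hx => hM (s, x) ⟨hs, hx⟩⟩

theorem toSpanSingleton_resolvent_eq_cfc {B : E →L[ℂ] E} (hB : IsSelfAdjoint B) {p q : ℂ}
    (h : ∀ x ∈ spectrum ℂ B, x ∉ segment ℝ p q) {s : ℝ} (hs : s ∈ Icc (0 : ℝ) 1) :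
    ContinuousLinearMap.toSpanSingleton ℂ
      ((AffineMap.lineMap p q s : ℂ) • resolvent B (AffineMap.lineMap p q s : ℂ)) (q - p) =
      cfc (segmentKernel p q s) B := by
  have hn : IsStarNormal B := hB.isStarNormal
  have hz : (AffineMap.lineMap p q s : ℂ) ∉ spectrum ℂ B :=
    fun hz => h _ hz (lineMap_mem_segment ℝ p q hs)
  have hc : ContinuousOn (fun x => (AffineMap.lineMap p q s - x : ℂ)⁻¹) (spectrum ℂ B) :=
    ContinuousOn.inv₀ (by fun_prop) fun x hx h0 => hz (sub_eq_zero.mp h0 ▸ hx)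
  rw [ContinuousLinearMap.toSpanSingleton_apply, resolvent_eq_cfc hB hz,
    ← cfc_const_mul _ _ B hc, ← cfc_const_mul _ _ B (hc.const_mul _)]
  rfl

theorem curveIntegrable_segment_resolvent {B : E →L[ℂ] E} (hB : IsSelfAdjoint B) {p q : ℂ}
    (h : ∀ x ∈ spectrum ℂ B, x ∉ segment ℝ p q) :
    CurveIntegrable (fun z : ℂ => ContinuousLinearMap.toSpanSingleton ℂ (z • resolvent B z))
      (Path.segment p q) := by
  have hn : IsStarNormal B := hB.isStarNormal
  obtain ⟨M, hM⟩ := exists_bound_segmentKernel (spectrum.isCompact B) h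
  rw [curveIntegrable_segment, intervalIntegrable_iff_integrableOn_Icc_of_le zero_le_one]
  refine (integrableOn_cfc (μ := volume) measurableSet_Icc (segmentKernel p q) (fun _ => M) B
    (continuousOn_segmentKernel h)
    (ae_restrict_of_forall_mem measurableSet_Icc hM) ?_).congr_fun
    (fun s hs => (toSpanSingleton_resolvent_eq_cfc hB h hs).symm) measurableSet_Icc
  exact (integrable_const M).hasFiniteIntegral

theorem lineIntegral_segment_resolvent {B : E →L[ℂ] E} (hB : IsSelfAdjoint B) {p q : ℂ}
    (h : ∀ x ∈ spectrum ℂ B, x ∉ segment ℝ p q) :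
    lineIntegral (Path.segment p q) (fun z => z • resolvent B z) =
      cfc (fun x => (q - p) + x * Complex.log ((p - x)⁻¹ * (q - x))) B := by
  have hn : IsStarNormal B := hB.isStarNormal
  obtain ⟨M, hM⟩ := exists_bound_segmentKernel (spectrum.isCompact B) h
  have key := cfc_setIntegral (μ := volume) measurableSet_Icc (segmentKernel p q) (fun _ => M) B
    (continuousOn_segmentKernel h)
    (ae_restrict_of_forall_mem measurableSet_Icc hM) (integrable_const M).hasFiniteIntegral
  rw [lineIntegral, curveIntegral_segment, intervalIntegral.integral_of_le zero_le_one,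
    ← integral_Icc_eq_integral_Ioc, setIntegral_congr_fun measurableSet_Icc
      (fun s hs => toSpanSingleton_resolvent_eq_cfc hB h hs), ← key]
  refine cfc_congr fun x hx => ?_
  rw [← integral_mul_inv_lineMap_sub (h x hx), intervalIntegral.integral_of_le zero_le_one,
    ← integral_Icc_eq_integral_Ioc]
  rfl

/-! ### The rectangular contour -/

theorem range_contour (l r : ℝ) :
    range (contour l r) = segment ℝ ((l : ℂ) + Complex.I) ((l : ℂ) - Complex.I) ∪
      (segment ℝ ((l : ℂ) - Complex.I) ((r : ℂ) - Complex.I) ∪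
      (segment ℝ ((r : ℂ) - Complex.I) ((r : ℂ) + Complex.I) ∪
      segment ℝ ((r : ℂ) + Complex.I) ((l : ℂ) + Complex.I))) := by
  simp only [contour, Path.trans_range, Path.range_segment]

/-- The function of `x` obtained by integrating `z / (z - x)` along the contour. -/
def contourFun (l r : ℝ) (x : ℂ) : ℂ :=
  x * (Complex.log (((l : ℂ) + Complex.I - x)⁻¹ * ((l : ℂ) - Complex.I - x)) +
    (Complex.log (((l : ℂ) - Complex.I - x)⁻¹ * ((r : ℂ) - Complex.I - x)) +
    (Complex.log (((r : ℂ) - Complex.I - x)⁻¹ * ((r : ℂ) + Complex.I - x)) +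
    Complex.log (((r : ℂ) + Complex.I - x)⁻¹ * ((l : ℂ) + Complex.I - x)))))

theorem lineIntegral_contour_resolvent {B : E →L[ℂ] E} (hB : IsSelfAdjoint B) {l r : ℝ}
    (h : ∀ x ∈ spectrum ℂ B, x ∉ range (contour l r)) :
    lineIntegral (contour l r) (fun z => z • resolvent B z) = cfc (contourFun l r) B := by
  have hn : IsStarNormal B := hB.isStarNormal
  simp only [range_contour, mem_union, not_or] at h
  have h1 := fun x hx => (h x hx).1
  have h2 := fun x hx => (h x hx).2.1
  have h3 := fun x hx => (h x hx).2.2.1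
  have h4 := fun x hx => (h x hx).2.2.2
  have i1 := curveIntegrable_segment_resolvent hB h1
  have i2 := curveIntegrable_segment_resolvent hB h2
  have i3 := curveIntegrable_segment_resolvent hB h3
  have i4 := curveIntegrable_segment_resolvent hB h4
  have e1 := lineIntegral_segment_resolvent hB h1
  have e2 := lineIntegral_segment_resolvent hB h2
  have e3 := lineIntegral_segment_resolvent hB h3
  have e4 := lineIntegral_segment_resolvent hB h4
  rw [lineIntegral] at e1 e2 e3 e4
  have c1 := continuousOn_log_div_sub h1
  have c2 := continuousOn_log_div_sub h2
  have c3 := continuousOn_log_div_sub h3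
  have c4 := continuousOn_log_div_sub h4
  rw [lineIntegral, contour, curveIntegral_trans i1 (i2.trans (i3.trans i4)),
    curveIntegral_trans i2 (i3.trans i4), curveIntegral_trans i3 i4, e1, e2, e3, e4,
    ← cfc_add B _ _ c3 c4, ← cfc_add B _ _ c2 (c3.fun_add c4),
    ← cfc_add B _ _ c1 (c2.fun_add (c3.fun_add c4))]
  -- The four increments `q - p` sum to zero around the closed contour; only the logarithms survive.
  refine cfc_congr fun x _ => ?_
  simp only [contourFun]
  ring

/-- The logarithm of a quotient along a segment on which `c * (z - x)` avoids the branch cut. -/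
theorem log_div_sub_eq {p q x c : ℂ}
    (h : ∀ z ∈ segment ℝ p q, c * (z - x) ∈ Complex.slitPlane) :
    Complex.log ((p - x)⁻¹ * (q - x)) = Complex.log (c * (q - x)) - Complex.log (c * (p - x)) := by
  have hx : x ∉ segment ℝ p q := fun hx => Complex.slitPlane_ne_zero (h x hx) (by simp)
  have hp : p - x ≠ 0 := fun h => hx (sub_eq_zero.mp h ▸ left_mem_segment ℝ p q)
  have hlog := integral_inv_lineMap_sub_eq_log (p := p) (q := q) (x := x) (c := (p - x)⁻¹)
    fun z hz => div_sub_mem_slitPlane hx hz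
  rw [inv_mul_cancel₀ hp, Complex.log_one, sub_zero] at hlog
  rw [← hlog, integral_inv_lineMap_sub_eq_log h]

theorem re_eq_of_mem_segment {p q z : ℂ} {a : ℝ} (hp : p.re = a) (hq : q.re = a)
    (hz : z ∈ segment ℝ p q) : z.re = a := by
  obtain ⟨s, u, hs, hu, hsu, rfl⟩ := hz
  simp [hp, hq, ← add_mul, hsu]

theorem im_eq_of_mem_segment {p q z : ℂ} {a : ℝ} (hp : p.im = a) (hq : q.im = a)
    (hz : z ∈ segment ℝ p q) : z.im = a := by
  obtain ⟨s, u, hs, hu, hsu, rfl⟩ := hz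
  simp [hp, hq, ← add_mul, hsu]

theorem re_eq_or_im_of_mem_contour {l r : ℝ} {z : ℂ} (hz : z ∈ range (contour l r)) :
    z.re = l ∨ z.re = r ∨ z.im = -1 ∨ z.im = 1 := by
  rw [range_contour] at hz
  rcases hz with hz | hz | hz | hz
  · exact Or.inl (re_eq_of_mem_segment (by simp) (by simp) hz)
  · exact Or.inr (Or.inr (Or.inl (im_eq_of_mem_segment (by simp) (by simp) hz)))
  · exact Or.inr (Or.inl (re_eq_of_mem_segment (by simp) (by simp) hz))
  · exact Or.inr (Or.inr (Or.inr (im_eq_of_mem_segment (by simp) (by simp) hz)))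

/-- The rectangle lies to the left of `x`, so the single branch `log (-(z - x))` serves all four
sides and the differences telescope. -/
theorem contourFun_of_lt {l r x : ℝ} (hlx : l < x) (hrx : r < x) : contourFun l r x = 0 := by
  have key : ∀ p q : ℂ, p.re < x → q.re < x → Complex.log ((p - x)⁻¹ * (q - x)) =
      Complex.log (-1 * (q - x)) - Complex.log (-1 * (p - x)) := fun p q hp hq =>
    log_div_sub_eq fun z hz => by
      refine Or.inl ?_
      obtain ⟨s, u, hs, hu, hsu, rfl⟩ := hz
      have : s * p.re + u * q.re < s * x + u * x := by
        rcases hs.eq_or_lt with rfl | hs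
        · have : u = 1 := by linarith
          subst this; linarith
        · nlinarith [mul_lt_mul_of_pos_left hp hs, mul_le_mul_of_nonneg_left hq.le hu]
      have h1 : s * x + u * x = x := by rw [← add_mul, hsu, one_mul]
      simp
      linarith
  rw [contourFun, key _ _ (by simpa) (by simpa), key _ _ (by simpa) (by simpa),
    key _ _ (by simpa) (by simpa), key _ _ (by simpa) (by simpa)]
  ring

/-- The principal branch of `log (z - x)` fails only on the left side, where `log (-(z - x))` is
used. Changing branch at the two left corners contributes `πi` each; the rest telescopes. -/
theorem contourFun_of_mem {l r x : ℝ} (hlx : l < x) (hrx : x < r) :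
    contourFun l r x = 2 * (Real.pi : ℂ) * Complex.I * x := by
  have e1 : Complex.log (((l : ℂ) + Complex.I - x)⁻¹ * ((l : ℂ) - Complex.I - x)) =
      Complex.log (-1 * ((l : ℂ) - Complex.I - x)) - Complex.log (-1 * ((l : ℂ) + Complex.I - x)) :=
    log_div_sub_eq fun z hz => Or.inl (by
      simp [re_eq_of_mem_segment (a := l) (by simp) (by simp) hz, hlx])
  have e2 := log_div_sub_eq (p := (l : ℂ) - Complex.I) (q := (r : ℂ) - Complex.I) (x := x) (c := 1)
    fun z hz => Or.inr (by
      simp [im_eq_of_mem_segment (a := -1) (by simp) (by simp) hz])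
  have e3 := log_div_sub_eq (p := (r : ℂ) - Complex.I) (q := (r : ℂ) + Complex.I) (x := x) (c := 1)
    fun z hz => Or.inl (by
      simp [re_eq_of_mem_segment (a := r) (by simp) (by simp) hz, hrx])
  have e4 := log_div_sub_eq (p := (r : ℂ) + Complex.I) (q := (l : ℂ) + Complex.I) (x := x) (c := 1)
    fun z hz => Or.inr (by
      simp [im_eq_of_mem_segment (a := 1) (by simp) (by simp) hz])
  have a1 : Complex.log (-1 * ((l : ℂ) - Complex.I - x)) =
      Complex.log ((l : ℂ) - Complex.I - x) + Real.pi * Complex.I := by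
    rw [Complex.log, Complex.log, neg_one_mul, norm_neg,
      Complex.arg_neg_eq_arg_add_pi_of_im_neg (by simp)]
    push_cast; ring
  have a2 : Complex.log (-1 * ((l : ℂ) + Complex.I - x)) =
      Complex.log ((l : ℂ) + Complex.I - x) - Real.pi * Complex.I := by
    rw [Complex.log, Complex.log, neg_one_mul, norm_neg,
      Complex.arg_neg_eq_arg_sub_pi_of_im_pos (by simp)]
    push_cast; ring
  rw [contourFun, e1, e2, e3, e4, a1, a2]
  simp only [one_mul]
  ring

/-- The negative part of a self-adjoint operator as a contour integral of its resolvent. -/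
theorem neg_negativePart_eq_lineIntegral {B : E →L[ℂ] E} (hB : IsSelfAdjoint B) {l r : ℝ}
    (hr : r < 0)
    (h : ∀ x : ℝ, (x : ℂ) ∈ spectrum ℂ B → l < x ∧ (x < r ∨ 0 ≤ x)) :
    -negativePart B = (1 / (2 * (Real.pi : ℂ) * Complex.I)) •
      lineIntegral (contour l r) (fun z => z • resolvent B z) := by
  have hn : IsStarNormal B := hB.isStarNormal
  have hreal : ∀ x ∈ spectrum ℂ B, x = (x.re : ℂ) := fun x hx => hB.mem_spectrum_eq_re hx
  have hav : ∀ x ∈ spectrum ℂ B, x ∉ range (contour l r) := fun x hx hc => by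
    have hx' := hreal x hx
    obtain ⟨h1, h2⟩ := h x.re (hx' ▸ hx)
    have him : x.im = 0 := by rw [hx']; simp
    rcases re_eq_or_im_of_mem_contour hc with h3 | h3 | h3 | h3
    · linarith
    · rcases h2 with h2 | h2 <;> linarith
    · linarith
    · linarith
  rw [lineIntegral_contour_resolvent hB hav, negativePart_eq_cfc hB, ← cfc_neg]
  have hpi : (2 * (Real.pi : ℂ) * Complex.I) ≠ 0 := by
    simp [Real.pi_ne_zero, Complex.I_ne_zero]
  have hval : ∀ x ∈ spectrum ℂ B, contourFun l r x =
      (2 * (Real.pi : ℂ) * Complex.I) * -((x.re⁻ : ℝ) : ℂ) := fun x hx => by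
    have hx' := hreal x hx
    obtain ⟨h1, h2⟩ := h x.re (hx' ▸ hx)
    rw [hx', Complex.ofReal_re]
    rcases h2 with h2 | h2
    · rw [contourFun_of_mem h1 h2, negPart_of_nonpos (by linarith)]
      push_cast; ring
    · rw [contourFun_of_lt h1 (by linarith), negPart_of_nonneg h2]
      simp
  rw [cfc_congr (g := fun x : ℂ => (2 * (Real.pi : ℂ) * Complex.I) * -((x.re⁻ : ℝ) : ℂ))
    (fun x hx => hval x hx),
    cfc_const_mul _ _ B (by fun_prop), smul_smul, one_div, inv_mul_cancel₀ hpi, one_smul]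

end General

theorem norm_sq_add_of_orthogonal {E : Type*} [NormedAddCommGroup E]
    [InnerProductSpace ℂ E] {x y : E} (h : inner ℂ x y = 0) :
    ‖x + y‖ ^ 2 = ‖x‖ ^ 2 + ‖y‖ ^ 2 := by
  simpa [sq] using norm_add_sq_eq_norm_sq_add_norm_sq_of_inner_eq_zero x y h

section General

variable {E : Type*} [NormedAddCommGroup E] [InnerProductSpace ℂ E] [CompleteSpace E]

/-! ### Lower bounds for self-adjoint operators -/

theorem orthogonal_range_of_isSelfAdjoint {B : E →L[ℂ] E} (hB : IsSelfAdjoint B) :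
    B.rangeᗮ = B.ker := by
  rw [ContinuousLinearMap.orthogonal_range, ← ContinuousLinearMap.star_eq_adjoint, hB.star_eq]

/-- The bound makes `B` injective with closed range, and the range is dense because its orthogonal
complement is the kernel. -/
theorem isUnit_of_lower_bound {B : E →L[ℂ] E} (hB : IsSelfAdjoint B) {c : ℝ} (hc : 0 < c)
    (h : ∀ ψ, c * ‖ψ‖ ≤ ‖B ψ‖) : IsUnit B := by
  rw [ContinuousLinearMap.isUnit_iff_bijective,
    ContinuousLinearMap.bijective_iff_dense_range_and_antilipschitz]
  refine ⟨?_, (Real.toNNReal c⁻¹), ?_⟩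
  · rw [Submodule.topologicalClosure_eq_top_iff, orthogonal_range_of_isSelfAdjoint hB,
      Submodule.eq_bot_iff]
    intro ψ hψ
    have h1 := h ψ
    rw [show B ψ = 0 from hψ, norm_zero] at h1
    exact norm_le_zero_iff.mp (nonpos_of_mul_nonpos_right h1 hc)
  · refine AddMonoidHomClass.antilipschitz_of_bound B fun ψ => ?_
    rw [Real.coe_toNNReal _ (by positivity), ← div_eq_inv_mul, le_div_iff₀ hc, mul_comm]
    exact h ψ

/-- A self-adjoint operator that is bounded below on the orthogonal complement of its kernel has a
spectral gap around `0`. -/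
theorem eq_zero_of_mem_spectrum_of_lower_bound {B : E →L[ℂ] E} (hB : IsSelfAdjoint B) {c : ℝ}
    (h : ∀ ψ ∈ B.kerᗮ, c * ‖ψ‖ ≤ ‖B ψ‖) {z : ℂ} (hz : z ∈ spectrum ℂ B) (hzc : ‖z‖ < c) :
    z = 0 := by
  by_contra hz0
  have hzre : z = (z.re : ℂ) := hB.mem_spectrum_eq_re hz
  have hsa : IsSelfAdjoint (algebraMap ℂ (E →L[ℂ] E) z - B) := by
    refine IsSelfAdjoint.sub ?_ hB
    rw [hzre]
    exact IsSelfAdjoint.algebraMap _ (Complex.conj_ofReal _)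
  -- `z - B` is multiplication by `z` on the kernel and is bounded below by `c - ‖z‖` on its
  -- complement; `B` preserves both, so the bounds combine by Pythagoras.
  set m : ℝ := min ‖z‖ (c - ‖z‖) with hm
  have hm0 : 0 < m := lt_min (norm_pos_iff.mpr hz0) (by linarith)
  refine spectrum.mem_iff.mp hz (isUnit_of_lower_bound hsa hm0 fun ψ => ?_)
  obtain ⟨k, hk, p, hp, rfl⟩ := B.ker.exists_add_mem_mem_orthogonal ψ
  have hBk : B k = 0 := hk
  have hBp : B p ∈ B.kerᗮ := fun u hu => by
    have h2 := (ContinuousLinearMap.isSelfAdjoint_iff_isSymmetric.mp hB) u p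
    simp only [ContinuousLinearMap.coe_coe] at h2
    rw [← h2, show B u = 0 from hu, inner_zero_left]
  have e : (algebraMap ℂ (E →L[ℂ] E) z - B) (k + p) = z • k + (z • p - B p) := by
    simp [Algebra.algebraMap_eq_smul_one, hBk, add_sub_assoc]
  have o1 : inner ℂ k p = 0 := hp k hk
  have o2 : inner ℂ (z • k) (z • p - B p) = 0 := by
    rw [inner_smul_left, inner_sub_right, inner_smul_right, o1, hBp k hk]
    simp
  have b1 : m * ‖k‖ ≤ ‖z • k‖ := by
    rw [norm_smul]; gcongr; exact min_le_left _ _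
  have b2 : m * ‖p‖ ≤ ‖z • p - B p‖ := by
    have h3 := norm_sub_norm_le (B p) (z • p)
    rw [norm_smul, norm_sub_rev] at h3
    have h4 : m * ‖p‖ ≤ (c - ‖z‖) * ‖p‖ := by gcongr; exact min_le_right _ _
    linarith [h p hp]
  rw [e]
  refine le_of_sq_le_sq ?_ (norm_nonneg _)
  rw [mul_pow, norm_sq_add_of_orthogonal o1, norm_sq_add_of_orthogonal o2, mul_add, ← mul_pow,
    ← mul_pow]
  gcongr

/-! ### Operators that are off-diagonal with respect to a projection -/

section Chiral

variable {B P : E →L[ℂ] E}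

theorem inner_projection_eq_zero (hP : IsSelfAdjoint P) (hPP : P * P = P) (φ ψ : E) :
    inner ℂ (P φ) (ψ - P ψ) = 0 := by
  have h := (ContinuousLinearMap.isSelfAdjoint_iff_isSymmetric.mp hP) φ (ψ - P ψ)
  simp only [ContinuousLinearMap.coe_coe] at h
  have h2 : P (P ψ) = P ψ := DFunLike.congr_fun hPP ψ
  rw [h, map_sub, h2, sub_self, inner_zero_right]

theorem norm_sq_eq_projection (hP : IsSelfAdjoint P) (hPP : P * P = P) (ψ : E) :
    ‖ψ‖ ^ 2 = ‖P ψ‖ ^ 2 + ‖ψ - P ψ‖ ^ 2 := by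
  rw [← norm_sq_add_of_orthogonal (inner_projection_eq_zero hP hPP ψ ψ), add_sub_cancel]

/-- The hypothesis `hBP` says `B P = (1 - P) B`: `B` exchanges the two sectors, so the images of the
two components stay orthogonal. -/
theorem norm_sq_apply_eq_of_chiral (hP : IsSelfAdjoint P) (hPP : P * P = P)
    (hBP : ∀ ψ, B (P ψ) = B ψ - P (B ψ)) (ψ : E) :
    ‖B ψ‖ ^ 2 = ‖B (P ψ)‖ ^ 2 + ‖B (ψ - P ψ)‖ ^ 2 := by
  rw [norm_sq_eq_projection hP hPP (B ψ), map_sub, hBP, sub_sub_cancel, add_comm]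

theorem lower_bound_of_chiral (hP : IsSelfAdjoint P) (hPP : P * P = P)
    (hBP : ∀ ψ, B (P ψ) = B ψ - P (B ψ)) {c : ℝ} (hc : 0 ≤ c)
    (h : ∀ ψ, c * ‖P ψ‖ ≤ ‖B (P ψ)‖) {ψ : E} (h' : c * ‖ψ - P ψ‖ ≤ ‖B (ψ - P ψ)‖) :
    c * ‖ψ‖ ≤ ‖B ψ‖ := by
  refine le_of_sq_le_sq ?_ (norm_nonneg _)
  rw [mul_pow, norm_sq_eq_projection hP hPP ψ, norm_sq_apply_eq_of_chiral hP hPP hBP ψ, mul_add,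
    ← mul_pow, ← mul_pow]
  gcongr
  exact h ψ

/-- A lower bound on one chiral sector gives the same lower bound on the orthogonal complement of
the kernel. -/
theorem lower_bound_orthogonal_ker_of_chiral (hB : IsSelfAdjoint B) (hP : IsSelfAdjoint P)
    (hPP : P * P = P) (hBP : ∀ ψ, B (P ψ) = B ψ - P (B ψ)) {c : ℝ} (hc : 0 ≤ c)
    (h : ∀ ψ, c * ‖P ψ‖ ≤ ‖B (P ψ)‖) : ∀ ψ ∈ B.kerᗮ, c * ‖ψ‖ ≤ ‖B ψ‖ := by
  -- In the other sector, the component of `B χ` is `B φ` with `φ = P χ`. From `‖B φ‖² = ⟪φ, B² φ⟫ ≤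
  -- ‖φ‖ ‖B² φ‖` and `c ‖φ‖ ≤ ‖B φ‖` one gets `c ‖B φ‖ ≤ ‖B² φ‖`.
  have hrange : ∀ χ, c * ‖B χ‖ ≤ ‖B (B χ)‖ := fun χ => by
    refine lower_bound_of_chiral hP hPP hBP hc h ?_
    rw [← hBP χ]
    rcases eq_or_ne (P χ) 0 with h0 | h0
    · simp [h0]
    · have h1 := h χ
      have hs := (ContinuousLinearMap.isSelfAdjoint_iff_isSymmetric.mp hB) (P χ) (B (P χ))
      simp only [ContinuousLinearMap.coe_coe] at hs
      have h2 : ‖B (P χ)‖ ^ 2 ≤ ‖P χ‖ * ‖B (B (P χ))‖ := by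
        have h3 := norm_inner_le_norm (𝕜 := ℂ) (P χ) (B (B (P χ)))
        rw [← hs, inner_self_eq_norm_sq_to_K] at h3
        simpa using h3
      have h4 : 0 < ‖P χ‖ := norm_pos_iff.mpr h0
      refine le_of_mul_le_mul_left ?_ h4
      nlinarith [mul_le_mul_of_nonneg_right h1 (norm_nonneg (B (P χ)))]
  intro ψ hψ
  -- The complement of the kernel is the closure of the range, and the estimate is a closed
  -- condition.
  have hcl : ψ ∈ closure (range B) := by
    rw [← orthogonal_range_of_isSelfAdjoint hB, Submodule.orthogonal_orthogonal_eq_closure] at hψ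
    exact hψ
  have hclosed : IsClosed {φ : E | c * ‖φ‖ ≤ ‖B φ‖} :=
    isClosed_le (by fun_prop) (by fun_prop)
  refine closure_minimal ?_ hclosed hcl
  rintro _ ⟨χ, rfl⟩
  exact hrange χ

end Chiral

end General

/-! ### Square-summable sequences -/

/-- A weighted one-sided estimate for square-summable sequences. -/
theorem tsum_sq_le_of_le_add_shift {x f ρ w : ℤ → ℝ} {r V : ℝ} {s : ℤ} (hr0 : 0 ≤ r) (hr : r < 1)
    (hx : ∀ k, 0 ≤ x k) (hf : ∀ k, 0 ≤ f k) (hxs : Summable fun k => x k ^ 2)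
    (hfs : Summable fun k => f k ^ 2) (hw : ∀ k, 1 ≤ w k) (hwV : ∀ k, w k ≤ V)
    (hρ : ∀ k, ρ k * w k ≤ r * w (k + s)) (h : ∀ k, x k ≤ f k + ρ k * x (k + s)) :
    ∑' k, x k ^ 2 ≤ (V / (1 - r)) ^ 2 * ∑' k, f k ^ 2 := by
  have hr' : 0 < 1 - r := by linarith
  have hV : 0 ≤ V := zero_le_one.trans ((hw 0).trans (hwV 0))
  have hw0 : ∀ k, 0 ≤ w k := fun k => zero_le_one.trans (hw k)
  -- The weights turn the variable ratio `ρ` into the constant `r < 1`.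
  set y : ℤ → ℝ := fun k => w k * x k with hy
  have hy0 : ∀ k, 0 ≤ y k := fun k => mul_nonneg (hw0 k) (hx k)
  have hys : Summable fun k => y k ^ 2 := by
    refine Summable.of_nonneg_of_le (fun k => sq_nonneg _) (fun k => ?_) (hxs.mul_left (V ^ 2))
    rw [hy, mul_pow]
    have := hwV k
    have := hw0 k
    gcongr
  have hshift : Summable fun k => y (k + s) ^ 2 :=
    (Equiv.addRight s).summable_iff.mpr hys
  have hpt : ∀ k, y k ^ 2 ≤ V ^ 2 / (1 - r) * f k ^ 2 + r * y (k + s) ^ 2 := fun k => by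
    have h1 : y k ≤ V * f k + r * y (k + s) := by
      calc y k ≤ w k * (f k + ρ k * x (k + s)) := mul_le_mul_of_nonneg_left (h k) (hw0 k)
        _ = w k * f k + (ρ k * w k) * x (k + s) := by ring
        _ ≤ V * f k + (r * w (k + s)) * x (k + s) :=
          add_le_add (mul_le_mul_of_nonneg_right (hwV k) (hf k))
            (mul_le_mul_of_nonneg_right (hρ k) (hx _))
        _ = V * f k + r * y (k + s) := by simp only [hy]; ring
    have h2 : y k ^ 2 ≤ (V * f k + r * y (k + s)) ^ 2 := by
      have := hy0 k
      gcongr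
    refine h2.trans ?_
    -- Convexity of the square with weights `1 - r` and `r`. After summation, shift invariance lets
    -- the `y` terms be absorbed on the left.
    have h3 : V ^ 2 / (1 - r) * f k ^ 2 + r * y (k + s) ^ 2 - (V * f k + r * y (k + s)) ^ 2 =
        r / (1 - r) * (V * f k - (1 - r) * y (k + s)) ^ 2 := by
      field_simp
      ring
    have h4 : 0 ≤ r / (1 - r) * (V * f k - (1 - r) * y (k + s)) ^ 2 := by positivity
    linarith
  have hsum := Summable.tsum_le_tsum hpt hys ((hfs.mul_left _).add (hshift.mul_left _))
  rw [(hfs.mul_left _).tsum_add (hshift.mul_left _), tsum_mul_left, tsum_mul_left,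
    show ∑' k, y (k + s) ^ 2 = ∑' k, y k ^ 2 from
      (Equiv.addRight s).tsum_eq (fun k => y k ^ 2)] at hsum
  have hxy : ∑' k, x k ^ 2 ≤ ∑' k, y k ^ 2 := by
    refine Summable.tsum_le_tsum (fun k => ?_) hxs hys
    have h0 := hx k
    have h1 : x k ≤ y k := le_mul_of_one_le_left h0 (hw k)
    gcongr
  refine hxy.trans ?_
  have h5 : (1 - r) * ∑' k, y k ^ 2 ≤ V ^ 2 / (1 - r) * ∑' k, f k ^ 2 := by linarith
  refine le_of_mul_le_mul_left (h5.trans (le_of_eq ?_)) hr'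
  field_simp

/-- Increasing weights that absorb finitely many large ratios. -/
theorem exists_weight {r R : ℝ} (hr : 0 < r) (N : ℕ) :
    ∃ V : ℝ, ∃ w : ℤ → ℝ, (∀ k, 1 ≤ w k) ∧ (∀ k, w k ≤ V) ∧ (∀ k, w k ≤ w (k + 2)) ∧
      ∀ k : ℤ, |k| ≤ N → R * w k ≤ r * w (k + 2) := by
  set Q : ℝ := max 1 (R / r) with hQ
  have hQ1 : 1 ≤ Q := le_max_left _ _
  have hRQ : R ≤ r * Q := by
    have : R / r ≤ Q := le_max_right _ _
    rwa [div_le_iff₀' hr] at this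
  -- The exponent climbs from `0` at `-N` to `2N + 1` at `N + 1`; the cap is `N + 1`, so that `k =
  -- N` still gains a factor `Q`.
  refine ⟨Q ^ (2 * N + 1), fun k => Q ^ (min k (N + 1) + N).toNat, fun k => one_le_pow₀ hQ1,
    fun k => pow_le_pow_right₀ hQ1 (by omega), fun k => pow_le_pow_right₀ hQ1 (by omega),
    fun k hk => ?_⟩
  rw [abs_le] at hk
  calc R * Q ^ (min k (N + 1) + N : ℤ).toNat ≤ r * Q * Q ^ (min k (N + 1) + N : ℤ).toNat := by
        gcongr
    _ = r * Q ^ ((min k (N + 1) + N : ℤ).toNat + 1) := by ring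
    _ ≤ r * Q ^ (min (k + 2) (N + 1) + N : ℤ).toNat := by
        gcongr
        omega

/-- Sequences controlled by their shift two steps to the right, with ratio at most `r < 1` outside
a finite window. -/
theorem exists_tsum_sq_le_of_le_add_two {r R : ℝ} (hr0 : 0 < r) (hr : r < 1) (N : ℕ) :
    ∃ K : ℝ, 0 ≤ K ∧ ∀ x f ρ : ℤ → ℝ, (∀ k, 0 ≤ x k) → (∀ k, 0 ≤ f k) →
      (Summable fun k => x k ^ 2) → (Summable fun k => f k ^ 2) → (∀ k, ρ k ≤ R) →
      (∀ k : ℤ, (N : ℤ) < |k| → ρ k ≤ r) → (∀ k, x k ≤ f k + ρ k * x (k + 2)) →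
      ∑' k, x k ^ 2 ≤ K * ∑' k, f k ^ 2 := by
  obtain ⟨V, w, hw1, hwV, hwm, hwR⟩ := exists_weight (R := R) hr0 N
  refine ⟨(V / (1 - r)) ^ 2, sq_nonneg _, fun x f ρ hx hf hxs hfs hρR hρr h =>
    tsum_sq_le_of_le_add_shift hr0.le hr hx hf hxs hfs hw1 hwV (fun k => ?_) h⟩
  have hw0 := zero_le_one.trans (hw1 k)
  rcases le_or_gt |k| N with hk | hk
  · exact (mul_le_mul_of_nonneg_right (hρR k) hw0).trans (hwR k hk)
  · exact mul_le_mul (hρr k hk) (hwm k) hw0 hr0.le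

/-- Sequences controlled by their shift two steps to the left, with ratio at most `r < 1` outside
a finite window. -/
theorem exists_tsum_sq_le_of_le_sub_two {r R : ℝ} (hr0 : 0 < r) (hr : r < 1) (N : ℕ) :
    ∃ K : ℝ, 0 ≤ K ∧ ∀ x f ρ : ℤ → ℝ, (∀ k, 0 ≤ x k) → (∀ k, 0 ≤ f k) →
      (Summable fun k => x k ^ 2) → (Summable fun k => f k ^ 2) → (∀ k, ρ k ≤ R) →
      (∀ k : ℤ, (N : ℤ) < |k| → ρ k ≤ r) → (∀ k, x k ≤ f k + ρ k * x (k - 2)) →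
      ∑' k, x k ^ 2 ≤ K * ∑' k, f k ^ 2 := by
  obtain ⟨K, hK, h⟩ := exists_tsum_sq_le_of_le_add_two (R := R) hr0 hr N
  refine ⟨K, hK, fun x f ρ hx hf hxs hfs hρR hρr hx' => ?_⟩
  have key := h (fun k => x (-k)) (fun k => f (-k)) (fun k => ρ (-k)) (fun k => hx _)
    (fun k => hf _) ((Equiv.neg ℤ).summable_iff.mpr hxs) ((Equiv.neg ℤ).summable_iff.mpr hfs)
    (fun k => hρR _) (fun k hk => hρr _ (by rwa [abs_neg])) (fun k => by
      rw [neg_add]; exact hx' (-k))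
  have ex : ∑' k, x (-k) ^ 2 = ∑' k, x k ^ 2 := (Equiv.neg ℤ).tsum_eq (fun k => x k ^ 2)
  have ef : ∑' k, f (-k) ^ 2 = ∑' k, f k ^ 2 := (Equiv.neg ℤ).tsum_eq (fun k => f k ^ 2)
  rwa [ex, ef] at key

/-! ### Vectors supported on one sublattice -/

theorem summable_norm_sq (ψ : Hil) : Summable fun n => ‖ψ n‖ ^ 2 := by
  have h2 : (0 : ℝ) < (2 : ℝ≥0∞).toReal := by norm_num
  simpa using (memℓp_gen_iff h2).mp (lp.memℓp ψ)

theorem norm_sq_eq_tsum (ψ : Hil) : ‖ψ‖ ^ 2 = ∑' n, ‖ψ n‖ ^ 2 := by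
  have h2 : (0 : ℝ) < (2 : ℝ≥0∞).toReal := by norm_num
  simpa using lp.norm_rpow_eq_tsum h2 ψ

theorem summable_norm_sq_shift (ψ : Hil) (s : ℤ) (τ : ℝ) :
    Summable fun k => (‖ψ (k + s)‖ / τ) ^ 2 := by
  simp only [div_pow]
  exact ((Equiv.addRight s).summable_iff.mpr (summable_norm_sq ψ)).div_const _

theorem tsum_norm_sq_shift (ψ : Hil) (s : ℤ) (τ : ℝ) :
    ∑' k, (‖ψ (k + s)‖ / τ) ^ 2 = ‖ψ‖ ^ 2 / τ ^ 2 := by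
  simp only [div_pow]
  rw [tsum_div_const, norm_sq_eq_tsum]
  congr 1
  exact (Equiv.addRight s).tsum_eq (fun k => ‖ψ k‖ ^ 2)

/-- The indicator sequence of the even integers. -/
def evenSeq : Seq :=
  ⟨fun n => if Even n then 1 else 0, memℓp_infty ⟨1, by
    rintro _ ⟨n, rfl⟩
    dsimp only
    split_ifs <;> simp⟩⟩

/-- The orthogonal projection onto the vectors supported on the even sublattice. -/
def evenProj : Hil →L[ℂ] Hil :=
  LinearMap.mkContinuous
    { toFun := fun ψ => ⟨_, memℓp_mul_comp evenSeq (Equiv.refl ℤ) (Equiv.refl ℤ) ψ⟩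
      map_add' := fun φ ψ => by
        ext n
        exact mul_add _ _ _
      map_smul' := fun c ψ => by
        ext n
        simp [mul_left_comm] }
    ‖evenSeq‖ (norm_mul_comp_le evenSeq (Equiv.refl ℤ) (Equiv.refl ℤ))

theorem evenProj_apply (ψ : Hil) (n : ℤ) : evenProj ψ n = if Even n then ψ n else 0 := by
  change (((if Even n then 1 else 0 : ℝ)) : ℂ) * ψ n = _
  split_ifs <;> simp

theorem isSelfAdjoint_evenProj : IsSelfAdjoint evenProj := by
  rw [ContinuousLinearMap.isSelfAdjoint_iff_isSymmetric]
  intro φ ψ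
  simp only [ContinuousLinearMap.coe_coe]
  rw [lp.inner_eq_tsum, lp.inner_eq_tsum]
  refine tsum_congr fun n => ?_
  rw [evenProj_apply, evenProj_apply]
  split_ifs <;> simp

theorem evenProj_mul_self : evenProj * evenProj = evenProj := by
  ext ψ n
  change evenProj (evenProj ψ) n = evenProj ψ n
  simp only [evenProj_apply]
  split_ifs <;> rfl

theorem hop_evenProj (a : Seq) (ψ : Hil) :
    hop a (evenProj ψ) = hop a ψ - evenProj (hop a ψ) := by
  ext n
  rw [lp.coeFn_sub, Pi.sub_apply, evenProj_apply, hop_apply, hop_apply, evenProj_apply,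
    evenProj_apply]
  rcases Int.even_or_odd n with hn | hn
  · have h1 : ¬ Even (n - 1) := by rw [Int.not_even_iff_odd]; exact hn.sub_odd odd_one
    have h2 : ¬ Even (n + 1) := by rw [Int.not_even_iff_odd]; exact hn.add_odd odd_one
    simp [hn, h1, h2]
  · have h1 : Even (n - 1) := hn.sub_odd odd_one
    have h2 : Even (n + 1) := hn.add_odd odd_one
    simp [Int.not_even_iff_odd.mpr hn, h1, h2]

/-- At the site `n`, even bonds are at least `M` and odd bonds at most `m`. -/
def EvenStrong (a : ℤ → ℝ) (m M : ℝ) (n : ℤ) : Prop :=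
  (Even n → M ≤ a n) ∧ (Odd n → a n ≤ m)

/-- At the site `n`, odd bonds are at least `M` and even bonds at most `m`. -/
def OddStrong (a : ℤ → ℝ) (m M : ℝ) (n : ℤ) : Prop :=
  (Even n → a n ≤ m) ∧ (Odd n → M ≤ a n)

/-- Row `k + 1` of the operator, solved for `ψ k`. -/
theorem norm_le_of_hop_succ {a : Seq} {τ : ℝ} (hτ : 0 < τ) (ha : ∀ n, τ ≤ a n) (ψ : Hil) (k : ℤ) :
    ‖ψ k‖ ≤ ‖hop a ψ (k + 1)‖ / τ + a (k + 1) / a k * ‖ψ (k + 2)‖ := by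
  have hk : 0 < a k := hτ.trans_le (ha k)
  have hk1 : 0 < a (k + 1) := hτ.trans_le (ha _)
  have e : ((a k : ℝ) : ℂ) * ψ k = hop a ψ (k + 1) - ((a (k + 1) : ℝ) : ℂ) * ψ (k + 2) := by
    rw [hop_apply, add_sub_cancel_right, add_assoc, one_add_one_eq_two, add_sub_cancel_right]
  have h1 : a k * ‖ψ k‖ ≤ ‖hop a ψ (k + 1)‖ + a (k + 1) * ‖ψ (k + 2)‖ := by
    have h := norm_sub_le (hop a ψ (k + 1)) (((a (k + 1) : ℝ) : ℂ) * ψ (k + 2))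
    rwa [← e, norm_mul, norm_mul, Complex.norm_real, Complex.norm_real, Real.norm_of_nonneg hk.le,
      Real.norm_of_nonneg hk1.le] at h
  have h2 : ‖ψ k‖ ≤ ‖hop a ψ (k + 1)‖ / a k + a (k + 1) / a k * ‖ψ (k + 2)‖ := by
    rw [div_mul_eq_mul_div, ← add_div, le_div_iff₀' hk]
    exact h1
  refine h2.trans ?_
  gcongr
  exact ha k

/-- Row `k - 1` of the operator, solved for `ψ k`. -/
theorem norm_le_of_hop_pred {a : Seq} {τ : ℝ} (hτ : 0 < τ) (ha : ∀ n, τ ≤ a n) (ψ : Hil) (k : ℤ) :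
    ‖ψ k‖ ≤ ‖hop a ψ (k + -1)‖ / τ + a (k - 2) / a (k - 1) * ‖ψ (k - 2)‖ := by
  have hk : 0 < a (k - 1) := hτ.trans_le (ha _)
  have hk1 : 0 < a (k - 2) := hτ.trans_le (ha _)
  have e : ((a (k - 1) : ℝ) : ℂ) * ψ k =
      hop a ψ (k + -1) - ((a (k - 2) : ℝ) : ℂ) * ψ (k - 2) := by
    rw [hop_apply, ← sub_eq_add_neg, sub_add_cancel, sub_sub, one_add_one_eq_two,
      add_sub_cancel_left]
  have h1 : a (k - 1) * ‖ψ k‖ ≤ ‖hop a ψ (k + -1)‖ + a (k - 2) * ‖ψ (k - 2)‖ := by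
    have h := norm_sub_le (hop a ψ (k + -1)) (((a (k - 2) : ℝ) : ℂ) * ψ (k - 2))
    rwa [← e, norm_mul, norm_mul, Complex.norm_real, Complex.norm_real, Real.norm_of_nonneg hk.le,
      Real.norm_of_nonneg hk1.le] at h
  have h2 : ‖ψ k‖ ≤ ‖hop a ψ (k + -1)‖ / a (k - 1) + a (k - 2) / a (k - 1) * ‖ψ (k - 2)‖ := by
    rw [div_mul_eq_mul_div, ← add_div, le_div_iff₀' hk]
    exact h1
  refine h2.trans ?_
  gcongr
  exact ha _

theorem EvenStrong.div_le {a : ℤ → ℝ} {m M : ℝ} {j k : ℤ} (hm : 0 < m) (hmM : m < M)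
    (hj : EvenStrong a m M j) (hk : EvenStrong a m M k) (hjo : Odd j) (hke : Even k) :
    a j / a k ≤ m / M :=
  div_le_div₀ hm.le (hj.2 hjo) (hm.trans hmM) (hk.1 hke)

theorem OddStrong.div_le {a : ℤ → ℝ} {m M : ℝ} {j k : ℤ} (hm : 0 < m) (hmM : m < M)
    (hj : OddStrong a m M j) (hk : OddStrong a m M k) (hje : Even j) (hko : Odd k) :
    a j / a k ≤ m / M :=
  div_le_div₀ hm.le (hj.1 hje) (hm.trans hmM) (hk.2 hko)

theorem bond_ratio_le {a : ℤ → ℝ} {τ A : ℝ} (hτ : 0 < τ) (ha : ∀ n, τ ≤ a n) (hA : ∀ n, a n ≤ A)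
    (j k : ℤ) : a j / a k ≤ A / τ :=
  div_le_div₀ (hτ.le.trans ((ha 0).trans (hA 0))) (hA j) hτ (ha k)

/-- Lower bound on the even sublattice when the even bonds dominate at both ends. -/
theorem exists_lower_bound_even_of_evenStrong {τ A m M : ℝ} (hτ : 0 < τ) (hm : 0 < m) (hmM : m < M)
    (N : ℕ) : ∃ K : ℝ, 0 ≤ K ∧ ∀ a : Seq, (∀ n, τ ≤ a n) → (∀ n, a n ≤ A) →
      (∀ n : ℤ, (N : ℤ) ≤ |n| → EvenStrong a m M n) →
      ∀ ψ : Hil, (∀ n, Odd n → ψ n = 0) → ‖ψ‖ ^ 2 ≤ K * ‖hop a ψ‖ ^ 2 := by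
  have hM : 0 < M := hm.trans hmM
  -- `K` is fixed before `a`, hence is uniform in the perturbation. The maximum with `0` covers the
  -- odd sites, where the ratio is set to `0`.
  obtain ⟨K, hK, h⟩ := exists_tsum_sq_le_of_le_add_two (R := max (A / τ) 0) (div_pos hm hM)
    ((div_lt_one hM).mpr hmM) (N + 1)
  refine ⟨K / τ ^ 2, by positivity, fun a ha hA hN ψ hψ => ?_⟩
  have key := h (fun k => ‖ψ k‖) (fun k => ‖hop a ψ (k + 1)‖ / τ)
    (fun k => if Even k then a (k + 1) / a k else 0) (fun k => norm_nonneg _)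
    (fun k => by positivity) (summable_norm_sq ψ) (summable_norm_sq_shift _ 1 τ) ?_ ?_ ?_
  · rw [tsum_norm_sq_shift, ← norm_sq_eq_tsum] at key
    exact key.trans (le_of_eq (by ring))
  · intro k
    dsimp only
    split_ifs
    · exact (bond_ratio_le hτ ha hA _ _).trans (le_max_left _ _)
    · exact le_max_right _ _
  · intro k hk
    dsimp only
    split_ifs with he
    · exact (hN (k + 1) (by grind)).div_le hm hmM (hN k (by grind)) he.add_one he
    · positivity
  · intro k
    dsimp only
    split_ifs with he
    · exact norm_le_of_hop_succ hτ ha ψ k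
    · rw [hψ k (Int.not_even_iff_odd.mp he), norm_zero]
      positivity

/-- Lower bound on the odd sublattice when the even bonds dominate at both ends. -/
theorem exists_lower_bound_odd_of_evenStrong {τ A m M : ℝ} (hτ : 0 < τ) (hm : 0 < m) (hmM : m < M)
    (N : ℕ) : ∃ K : ℝ, 0 ≤ K ∧ ∀ a : Seq, (∀ n, τ ≤ a n) → (∀ n, a n ≤ A) →
      (∀ n : ℤ, (N : ℤ) ≤ |n| → EvenStrong a m M n) →
      ∀ ψ : Hil, (∀ n, Even n → ψ n = 0) → ‖ψ‖ ^ 2 ≤ K * ‖hop a ψ‖ ^ 2 := by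
  have hM : 0 < M := hm.trans hmM
  -- On odd sites the contracting direction is to the left; the window `N + 2` keeps `k - 2` and `k
  -- - 1` in the asymptotic region.
  obtain ⟨K, hK, h⟩ := exists_tsum_sq_le_of_le_sub_two (R := max (A / τ) 0) (div_pos hm hM)
    ((div_lt_one hM).mpr hmM) (N + 2)
  refine ⟨K / τ ^ 2, by positivity, fun a ha hA hN ψ hψ => ?_⟩
  have key := h (fun k => ‖ψ k‖) (fun k => ‖hop a ψ (k + -1)‖ / τ)
    (fun k => if Odd k then a (k - 2) / a (k - 1) else 0) (fun k => norm_nonneg _)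
    (fun k => by positivity) (summable_norm_sq ψ) (summable_norm_sq_shift _ (-1) τ) ?_ ?_ ?_
  · rw [tsum_norm_sq_shift, ← norm_sq_eq_tsum] at key
    exact key.trans (le_of_eq (by ring))
  · intro k
    dsimp only
    split_ifs
    · exact (bond_ratio_le hτ ha hA _ _).trans (le_max_left _ _)
    · exact le_max_right _ _
  · intro k hk
    dsimp only
    split_ifs with ho
    · exact (hN (k - 2) (by grind)).div_le hm hmM (hN (k - 1) (by grind)) (by grind) (by grind)
    · positivity
  · intro k
    dsimp only
    split_ifs with ho
    · exact norm_le_of_hop_pred hτ ha ψ k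
    · rw [hψ k (Int.not_odd_iff_even.mp ho), norm_zero]
      positivity

/-- Lower bound on the even sublattice when the even bonds dominate at `+∞` and the odd ones at
`-∞`. -/
theorem exists_lower_bound_even_of_oddStrong_evenStrong {τ A m M : ℝ} (hτ : 0 < τ) (hm : 0 < m)
    (hmM : m < M) (N : ℕ) : ∃ K : ℝ, 0 ≤ K ∧ ∀ a : Seq, (∀ n, τ ≤ a n) → (∀ n, a n ≤ A) →
      (∀ n : ℤ, (N : ℤ) ≤ n → EvenStrong a m M n) → (∀ n : ℤ, n ≤ -(N : ℤ) → OddStrong a m M n) →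
      ∀ ψ : Hil, (∀ n, Odd n → ψ n = 0) → ‖ψ‖ ^ 2 ≤ K * ‖hop a ψ‖ ^ 2 := by
  have hM : 0 < M := hm.trans hmM
  obtain ⟨K, hK, h⟩ := exists_tsum_sq_le_of_le_add_two (R := max (A / τ) 0) (div_pos hm hM)
    ((div_lt_one hM).mpr hmM) N
  obtain ⟨K', hK', h'⟩ := exists_tsum_sq_le_of_le_sub_two (R := m / M) (div_pos hm hM)
    ((div_lt_one hM).mpr hmM) 0
  refine ⟨(K + K') / τ ^ 2, by positivity, fun a ha hA hR hL ψ hψ => ?_⟩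
  -- Cut at `-N`: the recurrence to the right never leaves `[-N, ∞)` and the one to the left never
  -- leaves `(-∞, -N)`, so the two pieces are estimated separately. On the left piece every ratio is
  -- already at most `m / M`.
  have s1 : Summable fun k : ℤ => (if -(N : ℤ) ≤ k then ‖ψ k‖ else 0) ^ 2 := by
    refine Summable.of_nonneg_of_le (fun k => sq_nonneg _) (fun k => ?_) (summable_norm_sq ψ)
    split_ifs <;> simp
  have s2 : Summable fun k : ℤ => (if k < -(N : ℤ) then ‖ψ k‖ else 0) ^ 2 := by
    refine Summable.of_nonneg_of_le (fun k => sq_nonneg _) (fun k => ?_) (summable_norm_sq ψ)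
    split_ifs <;> simp
  have hright := h (fun k => if -(N : ℤ) ≤ k then ‖ψ k‖ else 0) (fun k => ‖hop a ψ (k + 1)‖ / τ)
    (fun k => if Even k ∧ -(N : ℤ) ≤ k then a (k + 1) / a k else 0)
    (fun k => by dsimp only; split_ifs <;> simp)
    (fun k => by positivity) s1 (summable_norm_sq_shift _ 1 τ) ?_ ?_ ?_
  · have hleft := h' (fun k => if k < -(N : ℤ) then ‖ψ k‖ else 0)
      (fun k => ‖hop a ψ (k + -1)‖ / τ)
      (fun k => if Even k ∧ k < -(N : ℤ) then a (k - 2) / a (k - 1) else 0)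
      (fun k => by dsimp only; split_ifs <;> simp)
      (fun k => by positivity) s2 (summable_norm_sq_shift _ (-1) τ) ?_ ?_ ?_
    · rw [tsum_norm_sq_shift] at hleft hright
      have hsplit : ‖ψ‖ ^ 2 = ∑' k : ℤ, (if -(N : ℤ) ≤ k then ‖ψ k‖ else 0) ^ 2 +
          ∑' k : ℤ, (if k < -(N : ℤ) then ‖ψ k‖ else 0) ^ 2 := by
        rw [norm_sq_eq_tsum, ← s1.tsum_add s2]
        refine tsum_congr fun k => ?_
        split_ifs <;> first | omega | simp
      rw [hsplit]
      refine (add_le_add hright hleft).trans (le_of_eq (by ring))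
    all_goals
      have hr : ∀ k : ℤ, (if Even k ∧ k < -(N : ℤ) then a (k - 2) / a (k - 1) else 0) ≤ m / M := by
        intro k
        split_ifs with he
        · exact (hL (k - 2) (by omega)).div_le hm hmM (hL (k - 1) (by omega)) (by grind) (by grind)
        · positivity
    · exact hr
    · exact fun k _ => hr k
    · intro k
      dsimp only
      by_cases hk : k < -(N : ℤ)
      · rcases Int.even_or_odd k with he | ho
        · rw [if_pos hk, if_pos ⟨he, hk⟩, if_pos (by omega)]
          exact norm_le_of_hop_pred hτ ha ψ k
        · rw [if_pos hk, hψ k ho, norm_zero, if_neg (by grind), zero_mul, add_zero]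
          positivity
      · rw [if_neg hk, if_neg (by grind), zero_mul, add_zero]
        positivity
  · intro k
    dsimp only
    split_ifs
    · exact (bond_ratio_le hτ ha hA _ _).trans (le_max_left _ _)
    · exact le_max_right _ _
  · intro k hk
    dsimp only
    split_ifs with he
    · exact (hR (k + 1) (by grind)).div_le hm hmM (hR k (by grind)) he.1.add_one he.1
    · positivity
  · intro k
    dsimp only
    by_cases hk : -(N : ℤ) ≤ k
    · rcases Int.even_or_odd k with he | ho
      · rw [if_pos hk, if_pos ⟨he, hk⟩, if_pos (by omega)]
        exact norm_le_of_hop_succ hτ ha ψ k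
      · rw [if_pos hk, hψ k ho, norm_zero, if_neg (by grind), zero_mul, add_zero]
        positivity
    · rw [if_neg hk, if_neg (by grind), zero_mul, add_zero]
      positivity

/-! ### Zero modes -/

/-- Solutions of first-order linear recurrences on `ℤ`. -/
theorem exists_recurrence (c : ℤ → ℝ) (hc : ∀ k, c k ≠ 0) :
    ∃ u : ℤ → ℝ, u 0 = 1 ∧ ∀ k, u (k + 1) = c k * u k := by
  refine ⟨fun k => (∏ i ∈ Finset.range k.toNat, c i) *
    ∏ i ∈ Finset.range (-k).toNat, (c (-(i : ℤ) - 1))⁻¹, by simp, fun k => ?_⟩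
  rcases le_or_gt 0 k with hk | hk
  · lift k to ℕ using hk
    have e1 : ((k : ℤ) + 1).toNat = k + 1 := by omega
    have e2 : (-((k : ℤ) + 1)).toNat = 0 := by omega
    have e3 : (-(k : ℤ)).toNat = 0 := by omega
    beta_reduce
    rw [e1, e2, e3, Int.toNat_natCast, Finset.prod_range_succ]
    simp [mul_comm]
  · obtain ⟨n, rfl⟩ : ∃ n : ℕ, k = -(n : ℤ) - 1 := ⟨(-k - 1).toNat, by omega⟩
    have e1 : (-(n : ℤ) - 1 + 1).toNat = 0 := by omega
    have e2 : (-(n : ℤ) - 1).toNat = 0 := by omega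
    have e3 : (-(-(n : ℤ) - 1 + 1)).toNat = n := by omega
    have e4 : (-(-(n : ℤ) - 1)).toNat = n + 1 := by omega
    beta_reduce
    rw [e1, e2, e3, e4, Finset.prod_range_succ]
    have := hc (-(n : ℤ) - 1)
    simp only [Finset.range_zero, Finset.prod_empty, one_mul]
    field_simp

theorem eq_mul_of_recurrence {c : ℤ → ℝ} (hc : ∀ k, c k ≠ 0) {u : ℤ → ℝ} (hu0 : u 0 = 1)
    (hu : ∀ k, u (k + 1) = c k * u k) {v : ℤ → ℂ} (hv : ∀ k, v (k + 1) = (c k : ℂ) * v k) (k : ℤ) :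
    v k = v 0 * (u k : ℂ) := by
  induction k using Int.induction_on with
  | zero => simp [hu0]
  | succ n ih => rw [hv, hu, ih]; push_cast; ring
  | pred n ih =>
    have h1 := hv (-(n : ℤ) - 1)
    have h2 := hu (-(n : ℤ) - 1)
    rw [sub_add_cancel] at h1 h2
    have h3 : (c (-(n : ℤ) - 1) : ℂ) ≠ 0 := by exact_mod_cast hc _
    refine mul_left_cancel₀ h3 ?_
    rw [← h1, ih, h2]
    push_cast
    ring

/-- Ratio test at each end: near `-∞` the factors are at least `1 / r` in modulus, so `u` decays
when followed to the left. -/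
theorem summable_sq_of_recurrence {c : ℤ → ℝ} {u : ℤ → ℝ} (hu : ∀ k, u (k + 1) = c k * u k)
    {r : ℝ} (hr : r < 1) (hr0 : 0 < r) {N : ℕ} (hR : ∀ k : ℤ, N ≤ k → |c k| ≤ r)
    (hL : ∀ k : ℤ, k ≤ -(N : ℤ) → 1 ≤ r * |c k|) : Summable fun k => u k ^ 2 := by
  have hr2 : r ^ 2 < 1 := by nlinarith
  refine Summable.of_nat_of_neg ?_ ?_
  · refine summable_of_ratio_norm_eventually_le hr2
      ((eventually_ge_atTop N).mono fun n hn => ?_)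
    have h1 := hR n (by exact_mod_cast hn)
    push_cast
    rw [hu, norm_pow, norm_pow, ← mul_pow, norm_mul]
    exact pow_le_pow_left₀ (by positivity)
      (mul_le_mul_of_nonneg_right h1 (norm_nonneg (u n))) 2
  · refine summable_of_ratio_norm_eventually_le hr2
      ((eventually_ge_atTop N).mono fun n hn => ?_)
    have h1 := hL (-(n : ℤ) - 1) (by omega)
    have h2 := hu (-(n : ℤ) - 1)
    rw [sub_add_cancel] at h2
    push_cast
    rw [neg_add, ← sub_eq_add_neg, h2, norm_pow, norm_pow, ← mul_pow, norm_mul, ← mul_assoc]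
    refine pow_le_pow_left₀ (norm_nonneg _) ?_ 2
    exact le_mul_of_one_le_left (norm_nonneg _) h1

theorem memℓp_odd_extend {u : ℤ → ℝ} (hu : Summable fun k => u k ^ 2) :
    Memℓp (fun n : ℤ => if Odd n then ((u (n / 2) : ℝ) : ℂ) else 0) 2 := by
  have h2 : (0 : ℝ) < (2 : ℝ≥0∞).toReal := by norm_num
  rw [memℓp_gen_iff h2]
  have hinj : Function.Injective fun k : ℤ => 2 * k + 1 := fun a b h => by
    simpa using h
  rw [← hinj.summable_iff]
  · refine hu.congr fun k => ?_
    have e : (2 * k + 1) / 2 = k := by omega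
    simp [e]
  · intro n hn
    have : ¬ Odd n := fun ⟨k, hk⟩ => hn ⟨k, hk.symm⟩
    simp [this]

/-- A two-sided square-summable sequence placed on the odd sublattice. -/
def oddVector (u : ℤ → ℝ) (hu : Summable fun k => u k ^ 2) : Hil := ⟨_, memℓp_odd_extend hu⟩

theorem oddVector_apply (u : ℤ → ℝ) (hu : Summable fun k => u k ^ 2) (n : ℤ) :
    oddVector u hu n = if Odd n then ((u (n / 2) : ℝ) : ℂ) else 0 := rfl

/-- If even bonds dominate at `+∞` and odd bonds at `-∞`, and the operator is injective on the even
sublattice, then its kernel is spanned by a single vector supported on the odd sublattice. -/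
theorem finrank_ker_hop {a : Seq} {τ m M : ℝ} (hτ : 0 < τ) (ha : ∀ n, τ ≤ a n) (hm : 0 < m)
    (hmM : m < M) {N : ℕ} (hR : ∀ n : ℤ, (N : ℤ) ≤ n → EvenStrong a m M n)
    (hL : ∀ n : ℤ, n ≤ -(N : ℤ) → OddStrong a m M n)
    (heven : ∀ ψ : Hil, hop a (evenProj ψ) = 0 → evenProj ψ = 0) :
    Module.finrank ℂ (hop a).ker = 1 := by
  have hpos : ∀ n, 0 < a n := fun n => hτ.trans_le (ha n)
  have hM : 0 < M := hm.trans hmM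
  -- With `u k` standing for the entry at site `2k + 1`, row `2k + 2` of the kernel equation is `u
  -- (k + 1) = c k * u k`.
  set c : ℤ → ℝ := fun k => -(a (2 * k + 1) / a (2 * k + 2)) with hcdef
  have hcabs : ∀ k, |c k| = a (2 * k + 1) / a (2 * k + 2) := fun k => by
    rw [hcdef, abs_neg, abs_of_pos (div_pos (hpos _) (hpos _))]
  have hc : ∀ k, c k ≠ 0 := fun k => neg_ne_zero.mpr (div_pos (hpos _) (hpos _)).ne'
  obtain ⟨u, hu0, hu⟩ := exists_recurrence c hc
  have hsum : Summable fun k => u k ^ 2 := by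
    -- For `k ≤ -(N + 1)`, both `2k + 1` and `2k + 2` are at most `-N`.
    refine summable_sq_of_recurrence (N := N + 1) hu ((div_lt_one hM).mpr hmM) (div_pos hm hM)
      (fun k hk => ?_) (fun k hk => ?_)
    · rw [hcabs]
      exact (hR _ (by push_cast at hk; omega)).div_le hm hmM (hR _ (by push_cast at hk; omega))
        ⟨k, rfl⟩ ⟨k + 1, by ring⟩
    · rw [hcabs]
      have h1 := (hL (2 * k + 1) (by push_cast at hk; omega)).2 ⟨k, rfl⟩
      have h2 := (hL (2 * k + 2) (by push_cast at hk; omega)).1 ⟨k + 1, by ring⟩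
      rw [div_mul_div_comm, one_le_div (mul_pos hM (hpos _)), mul_comm M]
      calc a (2 * k + 2) * M ≤ m * M := by gcongr
        _ ≤ m * a (2 * k + 1) := by gcongr
  have hker : oddVector u hsum ∈ (hop a).ker := by
    rw [LinearMap.mem_ker]
    ext n
    change hop a (oddVector u hsum) n = 0
    rw [hop_apply, oddVector_apply, oddVector_apply]
    rcases Int.even_or_odd' n with ⟨k, rfl | rfl⟩
    · have h1 : Odd (2 * k - 1) := ⟨k - 1, by ring⟩
      have h2 : Odd (2 * k + 1) := ⟨k, rfl⟩
      have e1 : (2 * k - 1) / 2 = k - 1 := by omega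
      have e2 : (2 * k + 1) / 2 = k := by omega
      rw [if_pos h1, if_pos h2, e1, e2]
      have h3 := hu (k - 1)
      have e3 : 2 * (k - 1) + 1 = 2 * k - 1 := by ring
      have e4 : 2 * (k - 1) + 2 = 2 * k := by ring
      simp only [hcdef, sub_add_cancel, e3, e4] at h3
      have h4 : a (2 * k - 1) * u (k - 1) + a (2 * k) * u k = 0 := by
        rw [h3]
        have := (hpos (2 * k)).ne'
        field_simp
        ring
      have h5 := congrArg (fun x : ℝ => (x : ℂ)) h4
      push_cast at h5
      exact h5
    · have h1 : ¬ Odd (2 * k + 1 - 1) := by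
        rw [Int.not_odd_iff_even]; exact ⟨k, by ring⟩
      have h2 : ¬ Odd (2 * k + 1 + 1) := by
        rw [Int.not_odd_iff_even]; exact ⟨k + 1, by ring⟩
      rw [if_neg h1, if_neg h2]
      simp
  have hone : oddVector u hsum 1 = 1 := by
    rw [oddVector_apply, if_pos odd_one, show (1 : ℤ) / 2 = 0 by norm_num, hu0, Complex.ofReal_one]
  refine finrank_eq_one (⟨oddVector u hsum, hker⟩ : (hop a).ker) (fun h0 => ?_) fun ψ => ?_
  · have h1 : oddVector u hsum = 0 := congrArg Subtype.val h0
    rw [h1] at hone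
    simp at hone
  · obtain ⟨ψ, hψ⟩ := ψ
    have hψ0 : hop a ψ = 0 := hψ
    have hev : evenProj ψ = 0 := heven ψ (by rw [hop_evenProj, hψ0, map_zero, sub_zero])
    have hrec : ∀ k : ℤ, ψ (2 * (k + 1) + 1) = (c k : ℂ) * ψ (2 * k + 1) := fun k => by
      have h1 : hop a ψ (2 * k + 2) = 0 := by rw [hψ0]; rfl
      rw [hop_apply, show 2 * k + 2 - 1 = 2 * k + 1 by ring] at h1
      have h2 : ((a (2 * k + 2) : ℝ) : ℂ) ≠ 0 := by exact_mod_cast (hpos _).ne'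
      rw [show 2 * (k + 1) + 1 = 2 * k + 2 + 1 by ring]
      simp only [hcdef]
      push_cast
      field_simp
      linear_combination h1
    refine ⟨ψ 1, Subtype.ext ?_⟩
    ext n
    change ψ 1 * oddVector u hsum n = ψ n
    rw [oddVector_apply]
    rcases Int.even_or_odd' n with ⟨k, rfl | rfl⟩
    · have h1 : Even (2 * k) := even_two_mul k
      have h2 : evenProj ψ (2 * k) = 0 := by rw [hev]; rfl
      rw [evenProj_apply, if_pos h1] at h2
      rw [if_neg (Int.not_odd_iff_even.mpr h1), h2, mul_zero]
    · have e2 : (2 * k + 1) / 2 = k := by omega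
      have h3 := eq_mul_of_recurrence hc hu0 hu (v := fun k => ψ (2 * k + 1)) hrec k
      rw [if_pos ⟨k, rfl⟩, e2]
      simpa using h3.symm

/-! ### Perturbed dimerized chains -/

/-- The budget `3δ/4` consists of `δ/2` for the convergence of `t` and `δ/4` for `h`; a margin `δ/4`
on each side of `W` remains. -/
theorem evenStrong_of_abs_sub_lt {W δ : ℝ} {a : ℤ → ℝ} {n : ℤ}
    (h : |a n - dimerPlus W δ n| ≤ 3 * δ / 4) : EvenStrong a (W - δ / 4) (W + δ / 4) n := by
  rw [abs_le, dimerPlus] at h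
  constructor
  · intro hn
    rw [hn.neg_one_zpow] at h
    linarith
  · intro hn
    rw [hn.neg_one_zpow] at h
    linarith

theorem oddStrong_of_abs_sub_lt {W δ : ℝ} {a : ℤ → ℝ} {n : ℤ}
    (h : |a n - dimerMinus W δ n| ≤ 3 * δ / 4) : OddStrong a (W - δ / 4) (W + δ / 4) n := by
  rw [abs_le, dimerMinus] at h
  constructor
  · intro hn
    rw [hn.neg_one_zpow] at h
    linarith
  · intro hn
    rw [hn.neg_one_zpow] at h
    linarith

theorem abs_add_sub_le {t h : Seq} {δ d : ℝ} {n : ℤ} (hh : ‖h‖ ≤ δ / 4)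
    (ht : |t n - d| < δ / 2) : |(t + h) n - d| ≤ 3 * δ / 4 := by
  have h1 : |h n| ≤ ‖h‖ := lp.norm_apply_le_norm (by simp) h n
  have h2 := abs_add_le (t n - d) (h n)
  rw [lp.coeFn_add, Pi.add_apply, add_sub_right_comm]
  linarith

theorem IsHomoclinic.exists_nat {W δ : ℝ} {t : ℤ → ℝ} (h : IsHomoclinic W δ t) {ε : ℝ}
    (hε : 0 < ε) : ∃ N : ℕ, ∀ n : ℤ, (N : ℤ) ≤ |n| → |t n - dimerPlus W δ n| < ε := by
  obtain ⟨p, hp⟩ := eventually_atBot.mp (h.1.eventually_lt_const hε)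
  obtain ⟨q, hq⟩ := eventually_atTop.mp (h.2.eventually_lt_const hε)
  refine ⟨p.natAbs + q.natAbs, fun n hn => ?_⟩
  rcases le_or_gt 0 n with h0 | h0
  · rw [abs_of_nonneg h0] at hn
    exact hq n (by push_cast at hn; grind)
  · rw [abs_of_neg h0] at hn
    exact hp n (by push_cast at hn; grind)

theorem IsHeteroclinic.exists_nat {W δ : ℝ} {t : ℤ → ℝ} (h : IsHeteroclinic W δ t) {ε : ℝ}
    (hε : 0 < ε) : ∃ N : ℕ, (∀ n : ℤ, (N : ℤ) ≤ n → |t n - dimerPlus W δ n| < ε) ∧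
      ∀ n : ℤ, n ≤ -(N : ℤ) → |t n - dimerMinus W δ n| < ε := by
  obtain ⟨p, hp⟩ := eventually_atBot.mp (h.1.eventually_lt_const hε)
  obtain ⟨q, hq⟩ := eventually_atTop.mp (h.2.eventually_lt_const hε)
  refine ⟨p.natAbs + q.natAbs, fun n hn => hq n (by push_cast at hn; grind),
    fun n hn => hp n (by push_cast at hn; grind)⟩

/-- The two dimerized patterns differ by `2δ` at every site, so `t` cannot approach both at `-∞`. -/
theorem IsHomoclinic.not_isHeteroclinic {W δ : ℝ} (hδ : 0 < δ) {t : ℤ → ℝ}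
    (h : IsHomoclinic W δ t) : ¬ IsHeteroclinic W δ t := fun h' => by
  obtain ⟨n, hn, hn1, hn2⟩ := ((eventually_lt_atBot 0).and
    ((h.1.eventually_lt_const hδ).and (h'.1.eventually_lt_const hδ))).exists
  rw [abs_lt, dimerPlus] at hn1
  rw [abs_lt, dimerMinus] at hn2
  rcases Int.even_or_odd n with he | ho
  · rw [he.neg_one_zpow] at hn1 hn2
    linarith
  · rw [ho.neg_one_zpow] at hn1 hn2
    linarith

/-- The `+ 1` keeps the constant positive and finite even when `K' = 0`. -/
theorem inv_sqrt_mul_norm_le {E F : Type*} [NormedAddCommGroup E] [NormedAddCommGroup F] {x : E}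
    {y : F} {K K' : ℝ} (hK : 0 ≤ K) (hKK' : K ≤ K') (h : ‖x‖ ^ 2 ≤ K * ‖y‖ ^ 2) :
    (√(K' + 1))⁻¹ * ‖x‖ ≤ ‖y‖ := by
  have hK' : 0 < K' + 1 := by linarith
  refine le_of_sq_le_sq ?_ (norm_nonneg _)
  rw [mul_pow, inv_pow, Real.sq_sqrt hK'.le, inv_mul_le_iff₀ hK']
  refine h.trans ?_
  gcongr
  linarith

theorem evenProj_apply_of_odd (ψ : Hil) (n : ℤ) (hn : Odd n) : evenProj ψ n = 0 := by
  rw [evenProj_apply, if_neg (Int.not_even_iff_odd.mpr hn)]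

theorem sub_evenProj_apply_of_even (ψ : Hil) (n : ℤ) (hn : Even n) : (ψ - evenProj ψ) n = 0 := by
  rw [lp.coeFn_sub, Pi.sub_apply, evenProj_apply, if_pos hn, sub_self]

theorem half_le_add_apply {t h : Seq} {τ : ℝ} (ht : ∀ n, τ ≤ t n) (hh : ‖h‖ ≤ τ / 2) (n : ℤ) :
    τ / 2 ≤ (t + h) n := by
  have h1 : |h n| ≤ ‖h‖ := lp.norm_apply_le_norm (by simp) h n
  rw [lp.coeFn_add, Pi.add_apply]
  linarith [ht n, neg_abs_le (h n)]

theorem add_apply_le {t h : Seq} {τ : ℝ} (hh : ‖h‖ ≤ τ / 2) (n : ℤ) :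
    (t + h) n ≤ ‖t‖ + τ / 2 := by
  have h1 : |(t + h) n| ≤ ‖t + h‖ := lp.norm_apply_le_norm (by simp) (t + h) n
  linarith [le_abs_self ((t + h) n), norm_add_le t h]

/-- Uniform invertibility near a homoclinic configuration. -/
theorem IsHomoclinic.exists_lower_bound {W δ : ℝ} (hδ : 0 < δ) (hδW : δ < W) {t : Seq}
    (ht : IsHomoclinic W δ t) {τ : ℝ} (hτ : 0 < τ) (htτ : ∀ n, τ ≤ t n) :
    ∃ c > 0, ∃ η > 0, ∀ h : Seq, ‖h‖ ≤ η → ∀ ψ, c * ‖ψ‖ ≤ ‖hop (t + h) ψ‖ := by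
  obtain ⟨N, hN⟩ := ht.exists_nat (half_pos hδ)
  have hm : 0 < W - δ / 4 := by linarith
  have hmM : W - δ / 4 < W + δ / 4 := by linarith
  obtain ⟨K₀, hK₀, h₀⟩ := exists_lower_bound_even_of_evenStrong (A := ‖t‖ + τ / 2) (half_pos hτ) hm
    hmM N
  obtain ⟨K₁, hK₁, h₁⟩ := exists_lower_bound_odd_of_evenStrong (A := ‖t‖ + τ / 2) (half_pos hτ) hm
    hmM N
  refine ⟨(√(max K₀ K₁ + 1))⁻¹, by positivity, min (τ / 2) (δ / 4), by positivity,
    fun h hh ψ => ?_⟩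
  have hhτ := hh.trans (min_le_left _ _)
  have hhδ := hh.trans (min_le_right _ _)
  have hstrong : ∀ n : ℤ, (N : ℤ) ≤ |n| → EvenStrong (t + h : Seq) (W - δ / 4) (W + δ / 4) n :=
    fun n hn => evenStrong_of_abs_sub_lt (abs_add_sub_le hhδ (hN n hn))
  refine lower_bound_of_chiral isSelfAdjoint_evenProj evenProj_mul_self (hop_evenProj _)
    (by positivity) (fun φ => ?_) ?_
  · exact inv_sqrt_mul_norm_le hK₀ (le_max_left _ _) (h₀ (t + h) (half_le_add_apply htτ hhτ)
      (add_apply_le hhτ) hstrong _ (evenProj_apply_of_odd φ))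
  · exact inv_sqrt_mul_norm_le hK₁ (le_max_right _ _) (h₁ (t + h) (half_le_add_apply htτ hhτ)
      (add_apply_le hhτ) hstrong _ (sub_evenProj_apply_of_even ψ))

/-- Uniform spectral gap and simplicity of the zero mode near a heteroclinic configuration. -/
theorem IsHeteroclinic.exists_lower_bound {W δ : ℝ} (hδ : 0 < δ) (hδW : δ < W) {t : Seq}
    (ht : IsHeteroclinic W δ t) {τ : ℝ} (hτ : 0 < τ) (htτ : ∀ n, τ ≤ t n) :
    ∃ c > 0, ∃ η > 0, ∀ h : Seq, ‖h‖ ≤ η →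
      (∀ ψ ∈ (hop (t + h)).kerᗮ, c * ‖ψ‖ ≤ ‖hop (t + h) ψ‖) ∧
      Module.finrank ℂ (hop (t + h)).ker = 1 := by
  obtain ⟨N, hR, hL⟩ := ht.exists_nat (half_pos hδ)
  have hm : 0 < W - δ / 4 := by linarith
  have hmM : W - δ / 4 < W + δ / 4 := by linarith
  obtain ⟨K, hK, hbound⟩ := exists_lower_bound_even_of_oddStrong_evenStrong (A := ‖t‖ + τ / 2)
    (half_pos hτ) hm hmM N
  have hc : 0 < (√(K + 1))⁻¹ := by positivity
  refine ⟨(√(K + 1))⁻¹, hc, min (τ / 2) (δ / 4), by positivity, fun h hh => ?_⟩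
  have hhτ := hh.trans (min_le_left _ _)
  have hhδ := hh.trans (min_le_right _ _)
  have hR' : ∀ n : ℤ, (N : ℤ) ≤ n → EvenStrong (t + h : Seq) (W - δ / 4) (W + δ / 4) n :=
    fun n hn => evenStrong_of_abs_sub_lt (abs_add_sub_le hhδ (hR n hn))
  have hL' : ∀ n : ℤ, n ≤ -(N : ℤ) → OddStrong (t + h : Seq) (W - δ / 4) (W + δ / 4) n :=
    fun n hn => oddStrong_of_abs_sub_lt (abs_add_sub_le hhδ (hL n hn))
  have heven : ∀ ψ : Hil, (√(K + 1))⁻¹ * ‖evenProj ψ‖ ≤ ‖hop (t + h) (evenProj ψ)‖ := fun ψ =>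
    inv_sqrt_mul_norm_le hK le_rfl (hbound (t + h) (half_le_add_apply htτ hhτ) (add_apply_le hhτ)
      hR' hL' _ (evenProj_apply_of_odd ψ))
  refine ⟨lower_bound_orthogonal_ker_of_chiral (isSelfAdjoint_hop _) isSelfAdjoint_evenProj
    evenProj_mul_self (hop_evenProj _) hc.le heven, ?_⟩
  refine finrank_ker_hop (half_pos hτ) (half_le_add_apply htτ hhτ) hm hmM hR' hL' fun ψ h0 => ?_
  have h1 := heven ψ
  rw [h0, norm_zero] at h1
  exact norm_le_zero_iff.mp (nonpos_of_mul_nonpos_right h1 hc)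

/-! ### Spectra of small perturbations -/

theorem norm_hop_le (a : Seq) : ‖hop a‖ ≤ 2 * ‖a‖ :=
  LinearMap.mkContinuous_norm_le _ (by positivity) _

theorem hop_add (a b : Seq) : hop (a + b) = hop a + hop b := by
  ext ψ n
  change hop (a + b) ψ n = hop a ψ n + hop b ψ n
  simp only [hop_apply, lp.coeFn_add, Pi.add_apply]
  push_cast
  ring

theorem hop_ne_zero {a : Seq} (ha : 0 < a 0) : hop a ≠ 0 := fun h => by
  have h1 : hop a (lp.single 2 1 (1 : ℂ)) 0 = 0 := by rw [h]; rfl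
  rw [hop_apply] at h1
  simp [lp.single_apply] at h1
  exact ha.ne' h1

/-- Needed for a positive gap, since `Metric.infDist` to the empty set is `0`. -/
theorem spectrum_diff_zero_nonempty {E : Type*} [NormedAddCommGroup E] [InnerProductSpace ℂ E]
    [CompleteSpace E] {B : E →L[ℂ] E} (hB : IsSelfAdjoint B) (h0 : B ≠ 0) :
    (spectrum ℂ B \ {0}).Nonempty := by
  by_contra h
  rw [not_nonempty_iff_eq_empty, sdiff_eq_empty] at h
  exact h0 (CFC.eq_zero_of_spectrum_subset_zero (R := ℂ) B h hB.isStarNormal)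

theorem gap_le_norm {E : Type*} [NormedAddCommGroup E] [InnerProductSpace ℂ E]
    [CompleteSpace E] (B : E →L[ℂ] E) {x : ℂ} (hx : x ∈ spectrum ℂ B) (hx0 : x ≠ 0) :
    gap B ≤ ‖x‖ := by
  have h := Metric.infDist_le_dist_of_mem (x := (0 : ℂ)) (s := spectrum ℂ B \ {0}) ⟨hx, hx0⟩
  rwa [dist_zero_left] at h

/-- Lower bounds on the orthogonal complement of the kernel confine the spectrum of small
perturbations to `0` and the complement of `[-3g/4, 3g/4]`, where `g` is the unperturbed gap. -/
theorem eq_zero_or_of_mem_spectrum_add {E : Type*} [NormedAddCommGroup E] [InnerProductSpace ℂ E]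
    [CompleteSpace E] {B H : E →L[ℂ] E} (hB : IsSelfAdjoint B) (hH : IsSelfAdjoint H) {c : ℝ}
    (hHg : ‖H‖ < gap B / 4) (hHc : ‖H‖ < c)
    (h : ∀ ψ ∈ (B + H).kerᗮ, c * ‖ψ‖ ≤ ‖(B + H) ψ‖) {x : ℂ} (hx : x ∈ spectrum ℂ (B + H)) :
    x = 0 ∨ 3 * gap B / 4 < ‖x‖ := by
  -- Otherwise the Neumann series would make `x - (B + H)` invertible.
  have hex : ∃ y ∈ spectrum ℂ B, ‖x - y‖ < min (gap B / 4) c := by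
    by_contra! hcon
    exact spectrum.mem_iff.mp hx (isUnit_algebraMap_sub_add hB (lt_min hHg hHc) hcon)
  obtain ⟨y, hy, hxy⟩ := hex
  rcases eq_or_ne y 0 with rfl | hy0
  · rw [sub_zero] at hxy
    exact Or.inl (eq_zero_of_mem_spectrum_of_lower_bound (hB.add hH) h hx
      (hxy.trans_le (min_le_right _ _)))
  · right
    have h1 := gap_le_norm B hy hy0
    have h2 := norm_sub_norm_le y x
    rw [norm_sub_rev] at h2
    have h3 := hxy.trans_le (min_le_left _ _)
    linarith

/-- Distance from a point of the contour to a real point off the contour. -/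
theorem le_norm_sub_of_mem_contour {l r x d : ℝ} (hd : d ≤ 1) (hl : d ≤ |l - x|)
    (hr : d ≤ |r - x|) {z : ℂ} (hz : z ∈ range (contour l r)) : d ≤ ‖z - x‖ := by
  have hre : |z.re - x| ≤ ‖z - x‖ := by simpa using Complex.abs_re_le_norm (z - x)
  have him : |z.im| ≤ ‖z - x‖ := by simpa using Complex.abs_im_le_norm (z - x)
  rcases re_eq_or_im_of_mem_contour hz with h | h | h | h
  · exact hl.trans (h ▸ hre)
  · exact hr.trans (h ▸ hre)
  · exact hd.trans (by simpa [h] using him)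
  · exact hd.trans (by simpa [h] using him)

end SSH
end

/-! ### Choice of the constants and conclusion -/

theorem mainTheorem4 (W δ : ℝ) (hδ : 0 < δ) (hδW : δ < W)
    (t : SSH.Seq) (ht : SSH.IsHomoclinic W δ t ∨ SSH.IsHeteroclinic W δ t)
    (τ : ℝ) (hτ : 0 < τ) (htτ : ∀ n, τ ≤ t n) :
    0 < SSH.gap (SSH.hop t) ∧
    ∃ l : ℝ, l < -(SSH.gap (SSH.hop t)) / 2 ∧ ∃ C : ℝ, 0 ≤ C ∧ ∃ η : ℝ, 0 < η ∧
      ∀ h : SSH.Seq, ‖h‖ ≤ η →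
        (∀ z ∈ Set.range (SSH.contour l (-(SSH.gap (SSH.hop t)) / 2)),
          IsUnit (algebraMap ℂ (SSH.Hil →L[ℂ] SSH.Hil) z - (SSH.hop t + SSH.hop h)) ∧
            ‖resolvent (SSH.hop t + SSH.hop h) z‖ ≤ C) ∧
        -SSH.negativePart (SSH.hop t + SSH.hop h) =
          (1 / (2 * (Real.pi : ℂ) * Complex.I)) •
            SSH.lineIntegral (SSH.contour l (-(SSH.gap (SSH.hop t)) / 2))
              (fun z => z • resolvent (SSH.hop t + SSH.hop h) z) ∧
        (SSH.IsHomoclinic W δ t → (0 : ℂ) ∉ spectrum ℂ (SSH.hop t + SSH.hop h)) ∧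
        (SSH.IsHeteroclinic W δ t →
          SSH.IsSimpleIsolatedEigenvalue (SSH.hop t + SSH.hop h) 0) := by
  obtain ⟨c, hc, η₀, hη₀, hmain⟩ : ∃ c > 0, ∃ η > 0, ∀ h : SSH.Seq, ‖h‖ ≤ η →
      (∀ ψ ∈ (SSH.hop t + SSH.hop h).kerᗮ, c * ‖ψ‖ ≤ ‖(SSH.hop t + SSH.hop h) ψ‖) ∧
      (SSH.IsHomoclinic W δ t → IsUnit (SSH.hop t + SSH.hop h)) ∧
      (SSH.IsHeteroclinic W δ t →
        Module.finrank ℂ (SSH.hop t + SSH.hop h).ker = 1) := by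
    rcases ht with ht | ht
    · obtain ⟨c, hc, η, hη, h1⟩ := ht.exists_lower_bound hδ hδW hτ htτ
      refine ⟨c, hc, η, hη, fun h hh => ?_⟩
      rw [← SSH.hop_add]
      exact ⟨fun ψ _ => h1 h hh ψ,
        fun _ => SSH.isUnit_of_lower_bound (SSH.isSelfAdjoint_hop _) hc (h1 h hh),
        fun h' => (ht.not_isHeteroclinic hδ h').elim⟩
    · obtain ⟨c, hc, η, hη, h1⟩ := ht.exists_lower_bound hδ hδW hτ htτ
      refine ⟨c, hc, η, hη, fun h hh => ?_⟩
      rw [← SSH.hop_add]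
      exact ⟨(h1 h hh).1, fun h' => (h'.not_isHeteroclinic hδ ht).elim, fun _ => (h1 h hh).2⟩
  have hT := SSH.isSelfAdjoint_hop t
  set g := SSH.gap (SSH.hop t) with hgdef
  -- The uniform bound at `h = 0` gives `g ≥ c`.
  have hg : 0 < g := by
    refine hc.trans_le ((Metric.le_infDist (SSH.spectrum_diff_zero_nonempty hT
      (SSH.hop_ne_zero (hτ.trans_le (htτ 0))))).mpr fun y hy => ?_)
    rw [dist_zero_left]
    by_contra! hlt
    have h0 : SSH.hop t + SSH.hop 0 = SSH.hop t := by rw [← SSH.hop_add, add_zero]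
    have hb := (hmain 0 (by simpa using hη₀.le)).1
    rw [h0] at hb
    exact hy.2 (SSH.eq_zero_of_mem_spectrum_of_lower_bound hT hb hy.1 hlt)
  have hD : 0 < min (g / 4) 1 := by positivity
  -- Since `‖H‖ ≤ 2‖h‖`, the bounds `g / 9` and `c / 3` give `‖H‖ < g / 4` and `‖H‖ < c`. The left
  -- edge is then at distance at least `1` from the spectrum, and the right edge at least `g / 4`.
  refine ⟨hg, -(‖SSH.hop t‖ + g + 1), by linarith [norm_nonneg (SSH.hop t)], (min (g / 4) 1)⁻¹,
    by positivity, min η₀ (min (g / 9) (c / 3)), by positivity, fun h hh => ?_⟩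
  have hH := SSH.isSelfAdjoint_hop h
  have hnorm : ‖SSH.hop h‖ ≤ 2 * ‖h‖ := SSH.norm_hop_le h
  have hhg : ‖h‖ ≤ g / 9 := hh.trans ((min_le_right _ _).trans (min_le_left _ _))
  have hhc : ‖h‖ ≤ c / 3 := hh.trans ((min_le_right _ _).trans (min_le_right _ _))
  obtain ⟨hlow, hhom, hhet⟩ := hmain h (hh.trans (min_le_left _ _))
  have hB : IsSelfAdjoint (SSH.hop t + SSH.hop h) := hT.add hH
  have hspec : ∀ x : ℝ, (x : ℂ) ∈ spectrum ℂ (SSH.hop t + SSH.hop h) →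
      -(‖SSH.hop t‖ + g + 1) + 1 < x ∧ (x < -3 * g / 4 ∨ 0 ≤ x) := fun x hx => by
    have h1 := SSH.eq_zero_or_of_mem_spectrum_add hT hH (by linarith) (by linarith) hlow hx
    have h2 := (spectrum.norm_le_norm_mul_of_mem hx).trans
      (mul_le_of_le_one_right (norm_nonneg _) ContinuousLinearMap.norm_id_le)
    have h3 := norm_add_le (SSH.hop t) (SSH.hop h)
    rw [Complex.norm_real, Real.norm_eq_abs] at h2
    refine ⟨by linarith [neg_abs_le x], ?_⟩
    rcases h1 with h1 | h1
    · right
      exact (Complex.ofReal_eq_zero.mp h1).ge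
    · rw [Complex.norm_real, Real.norm_eq_abs] at h1
      rcases lt_or_ge x 0 with h4 | h4
      · left
        rw [abs_of_neg h4] at h1
        linarith
      · exact Or.inr h4
  have hdist : ∀ z ∈ Set.range (SSH.contour (-(‖SSH.hop t‖ + g + 1)) (-g / 2)),
      ∀ x ∈ spectrum ℂ (SSH.hop t + SSH.hop h), min (g / 4) 1 ≤ ‖z - x‖ := fun z hz x hx => by
    have hx' : x = (x.re : ℂ) := hB.mem_spectrum_eq_re hx
    obtain ⟨h1, h2⟩ := hspec x.re (hx' ▸ hx)
    rw [hx']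
    refine SSH.le_norm_sub_of_mem_contour (min_le_right _ _) ?_ ?_ hz
    · refine (min_le_right _ _).trans ?_
      rw [abs_sub_comm]
      exact (by linarith : (1 : ℝ) ≤ _).trans (le_abs_self _)
    · refine (min_le_left _ _).trans ?_
      rcases h2 with h2 | h2
      · exact (by linarith : g / 4 ≤ _).trans (le_abs_self _)
      · rw [abs_sub_comm]
        exact (by linarith : g / 4 ≤ _).trans (le_abs_self _)
  refine ⟨fun z hz => ⟨?_, SSH.norm_resolvent_le hB hD (hdist z hz)⟩, ?_, fun h' => ?_, fun h' => ?_⟩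
  · refine spectrum.notMem_iff.mp fun hzs => ?_
    have h1 := hdist z hz z hzs
    rw [sub_self, norm_zero] at h1
    exact absurd hD (not_lt.mpr h1)
  · refine SSH.neg_negativePart_eq_lineIntegral hB (by linarith) fun x hx => ?_
    obtain ⟨h1, h2⟩ := hspec x hx
    exact ⟨by linarith, h2.imp_left fun h3 => by linarith⟩
  · exact (spectrum.zero_notMem_iff ℂ).mpr (hhom h')
  · have hfin := hhet h'
    have hfin' : Module.finrank ℂ (Module.End.eigenspace
        ((SSH.hop t + SSH.hop h : SSH.Hil →L[ℂ] SSH.Hil) : SSH.Hil →ₗ[ℂ] SSH.Hil) 0) = 1 := by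
      rw [Module.End.eigenspace_zero]
      exact hfin
    have hev : Module.End.HasEigenvalue
        ((SSH.hop t + SSH.hop h : SSH.Hil →L[ℂ] SSH.Hil) : SSH.Hil →ₗ[ℂ] SSH.Hil) 0 := by
      rw [Module.End.hasEigenvalue_iff]
      intro hbot
      rw [hbot, finrank_bot] at hfin'
      exact zero_ne_one hfin'
    -- The lower bound `c` on the complement of the kernel serves as isolation radius.
    refine ⟨hev, hfin', c, hc, Set.Subset.antisymm (fun x hx => ?_) ?_⟩
    · exact SSH.eq_zero_of_mem_spectrum_of_lower_bound hB hlow hx.1 (by simpa using hx.2)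
    · rintro _ rfl
      refine ⟨?_, Metric.mem_ball_self hc⟩
      rw [spectrum.zero_mem_iff]
      intro hu
      obtain ⟨v, hv⟩ := hev.exists_hasEigenvector
      have hv0 : (SSH.hop t + SSH.hop h) v = 0 := by simpa using hv.apply_eq_smul
      have hinj := (ContinuousLinearMap.isUnit_iff_bijective.mp hu).1
      exact hv.2 (hinj (hv0.trans (map_zero _).symm))
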